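/- Let $p_2\in(1,2]$ and $\delta>0$. There is a weight $w\ge 0$ on $\mathbb R$ such that $w-1\in L^{p_2}(\mathbb R)$, $$[w]_{A_2(\mathbb R)}=\sup_I\Big(\frac1{|I|}\int_I w\Big)\Big(\frac1{|I|}\int_I w^{-1}\Big)\le 1+\delta ,$$ where $I$ ranges over the bounded intervals of positive length, the solution $P(r,\lambda;w)$, $r\ge0$, of the Krein system generated by $w$ is well defined (exists and is unique), and, simultaneously for every $p\in(0,p_2)$, $$\sup_{r\ge 0}\|P(r,\lambda;w)-e^{i\lambda r}\|_{L^p_w(\mathbb R)}=\infty ,$$ where $\|f\|_{L^p_w(\mathbb R)}^p=\int_{\mathbb R}|f(\lambda)|^p\,w(\lambda)\,d\lambda$. Here $P(r,\lambda;w)$ is defined as follows. Let $d\sigma=w(\lambda)\frac{d\lambda}{2\pi}$, with $\int(1+\lambda^2)^{-1}d\sigma<\infty$. The accelerant of $\sigma$ is the function $H\in L^2_{\rm loc}(\mathbb R)$ with $H(-x)=\overline{H(x)}$ such that, for some $\beta\in\mathbb R$ and all $x\in\mathbb R$, $$\int_0^x(x-s)H(s)\,ds=i\beta x+\int_{\mathbb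 R}\Big(1+\frac{i\lambda x}{1+\lambda^2}-e^{i\lambda x}\Big)\frac1{\lambda^2}\Big(d\sigma(\lambda)-\frac{d\lambda}{2\pi}\Big).$$ For $r>0$ let $\mathcal H_rf(x)=\int_0^rH(x-y)f(y)\,dy$ on $L^2([0,r])$; it is required that $I+\mathcal H_r>0$. Let $\Gamma_r$ be the kernel of $I-(I+\mathcal H_r)^{-1}$, i.e. for each $t\in[0,r]$, $\Gamma_r(t,\cdot)\in L^2([0,r])$ and $\Gamma_r(t,s)+\int_0^r\Gamma_r(t,u)H(u-s)\,du=H(t-s)$ for almost every $s\in[0,r]$. Then $$P(r,\lambda;w)=e^{i\lambda r}-\int_0^r\Gamma_r(r,t)\,e^{i\lambda t}\,dt .$$ -/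

import Mathlib

open MeasureTheory Set
open scoped NNReal ENNReal ComplexConjugate

noncomputable section

namespace Krein

/-- The Muckenhoupt characteristic `[w]_{A_p(ℝ)}`: the supremum over all bounded intervals `(a, b)`
of `⟨w⟩_I ⟨w^{1/(1-p)}⟩_I^{p-1}`, as an extended nonnegative number (the averages are lower
Lebesgue integrals, so nothing is lost where one of them is infinite). -/
def apCharacteristic (p : ℝ) (w : ℝ → ℝ) : ℝ≥0∞ :=
  ⨆ (a : ℝ) (b : ℝ) (_ : a < b),
    ((∫⁻ x in Ioo a b, ENNReal.ofReal (w x)) / ENNReal.ofReal (b - a)) *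
    ((∫⁻ x in Ioo a b, ENNReal.ofReal (w x) ^ (1 / (1 - p))) / ENNReal.ofReal (b - a)) ^ (p - 1)

/-- The measure `w(x) dx` on `ℝ`. -/
def weightMeasure (w : ℝ → ℝ) : Measure ℝ :=
  volume.withDensity fun x => ENNReal.ofReal (w x)

/-- The spectral measure `dσ = w(x) dx / (2π)` on `ℝ`. -/
def spectralMeasure (w : ℝ → ℝ) : Measure ℝ :=
  volume.withDensity fun x => ENNReal.ofReal (w x / (2 * Real.pi))

/-- `(1 + i ξ x / (1 + ξ²) - e^{i ξ x}) / ξ²`, with its limit `x² / 2` at `ξ = 0`. -/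
def accelerantKernel (x ξ : ℝ) : ℂ :=
  if ξ = 0 then ((x ^ 2 / 2 : ℝ) : ℂ)
  else (1 + Complex.I * ξ * x / (1 + (ξ : ℂ) ^ 2) - Complex.exp (Complex.I * ξ * x)) / (ξ : ℂ) ^ 2

/-- `H` is the accelerant of the Poisson-finite measure `σ`: `H` is Hermitian, locally square
integrable, and for some real `β`
`∫_0^x (x-s) H(s) ds = iβx + ∫ (1 + iξx/(1+ξ²) - e^{iξx}) ξ⁻² (dσ(ξ) - dξ/(2π))` for all `x`.
The kernel is `O((1+ξ²)⁻¹)`, so the last integral is the difference of two convergent ones. -/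
structure IsAccelerant (σ : Measure ℝ) (H : ℝ → ℂ) : Prop where
  poisson_finite : Integrable (fun ξ : ℝ => (1 + ξ ^ 2)⁻¹) σ
  hermitian : ∀ x, H (-x) = conj (H x)
  locL2 : ∀ R : ℝ, MemLp H 2 (volume.restrict (Icc (-R) R))
  eqn : ∃ β : ℝ, ∀ x : ℝ,
    ∫ s in (0 : ℝ)..x, ((x - s : ℝ) : ℂ) * H s =
      Complex.I * β * x +
        ((∫ ξ, accelerantKernel x ξ ∂σ) - (2 * Real.pi : ℂ)⁻¹ * ∫ ξ, accelerantKernel x ξ)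

/-- The truncated convolution operator `(𝓗_r f)(x) = ∫_0^r H(x-y) f(y) dy`. -/
def truncConv (H : ℝ → ℂ) (r : ℝ) (f : ℝ → ℂ) (x : ℝ) : ℂ :=
  ∫ y in (0 : ℝ)..r, H (x - y) * f y

/-- `I + 𝓗_r > 0` on `L²([0,r])`. -/
def IsPositive (H : ℝ → ℂ) (r : ℝ) : Prop :=
  ∀ f : ℝ → ℂ, MemLp f 2 (volume.restrict (Icc 0 r)) →
    ¬ (f =ᵐ[volume.restrict (Icc 0 r)] 0) →
    0 < (∫ x in (0 : ℝ)..r, (f x + truncConv H r f x) * conj (f x)).re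

/-- `Γ` is the resolvent kernel on `[0,r]²`, the kernel of `𝓖_r = I - (I + 𝓗_r)⁻¹`.
Written for kernels, `𝓖_r (I + 𝓗_r) = 𝓗_r` says that each row `Γ(t, ·)` is the element of
`L²([0,r])` with `Γ(t,s) + ∫_0^r Γ(t,u) H(u-s) du = H(t-s)`. -/
structure IsResolventKernel (H : ℝ → ℂ) (r : ℝ) (Γ : ℝ → ℝ → ℂ) : Prop where
  memLp : ∀ t ∈ Icc 0 r, MemLp (Γ t) 2 (volume.restrict (Icc 0 r))
  resolvent : ∀ t ∈ Icc 0 r, ∀ᵐ s ∂(volume.restrict (Icc 0 r)),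
    Γ t s + ∫ u in (0 : ℝ)..r, Γ t u * H (u - s) = H (t - s)

/-- `P(r, ξ)`, `r ≥ 0`, `ξ ∈ ℝ`, are the continuous orthonormal polynomials of `σ` (the solution
of the Krein system generated by `σ`): `σ` has an accelerant `H` with `I + 𝓗_r > 0` for all
`r > 0`, and `P(r, ξ) = e^{iξr} - ∫_0^r Γ_r(r,t) e^{iξt} dt` with the resolvent kernels `Γ_r`. -/
def IsKreinSolution (σ : Measure ℝ) (P : ℝ≥0 → ℝ → ℂ) : Prop :=
  ∃ H : ℝ → ℂ, IsAccelerant σ H ∧ (∀ r : ℝ, 0 < r → IsPositive H r) ∧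
    ∃ Γ : ℝ≥0 → ℝ → ℝ → ℂ, (∀ r : ℝ≥0, IsResolventKernel H r (Γ r)) ∧
      ∀ (r : ℝ≥0) (ξ : ℝ), P r ξ = Complex.exp (Complex.I * ξ * (r : ℝ)) -
        ∫ t in (0 : ℝ)..(r : ℝ), Γ r r t * Complex.exp (Complex.I * ξ * t)

end Krein

end

/-!
The weight is `w = 1 + Ĥ`, where `H` is real, even, in `L¹ ∩ L²`, with `‖H‖₁ < 1` and `0 ≤ Ĥ ≤ ε`, and
where `Ĥ` lies in `L^{p₂}` but in no `L^p` with `p < p₂`; a lacunary sum of Gaussians does it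
(`exists_isSmallKernel`). Since `1 ≤ w ≤ 1 + ε`, the `A₂` characteristic is at most `1 + ε`.

The accelerant of `w` is `H`. For the existence, the kernel of the accelerant equation is the Fourier
transform of an explicit integrable function (`ft_accelerantDual`), so that the equation is Parseval's
identity (`integral_mul_accelerantDual`). For the uniqueness, `∫_0^x (x - s) H(s) ds` determines `H` up
to null sets, even modulo linear functions of `x` (`IsAccelerant.ae_eq`). As `‖H‖₁ < 1`, convolution
with `H` is a contraction of `L¹` and of `L²`, hence `I + 𝓗_r > 0` and the resolvent kernels exist and
are unique; this gives the solution `P` of the Krein system and its uniqueness.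

The reflected row `A_r(s) = Γ_r(r, r - s)` solves the Wiener–Hopf equation `A + H * A = H` truncated to
`[0, r]`, and `P(r, ξ) - e^{iξr} = -e^{iξr} Â_r(ξ)`. The contraction estimate shows that `A_r` tends in
`L¹` to the solution `A` of the equation on the half-line, so `Â_r → Â` pointwise
(`IsSmallKernel.tendsto_ft`). The Wiener–Hopf factorization gives `w |1 - Â|² = 1`
(`one_add_ft_mul_normSq`), whence `|w - 1| ≤ 4 |Â|`. If the norms of `P(r, ·) - e^{i r ·}` in `L^p_w` were
bounded, Fatou's lemma would put `Â`, and therefore `w - 1 = Ĥ`, into `L^p`, which is false for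
`p < p₂` (`IsSmallKernel.iSup_eLpNorm_eq_top`).
-/

open Filter Topology FourierTransform

namespace Krein

/-! ### Convolution with integrable functions -/

/-- The convolution `(f * g)(x) = ∫ f(x - y) g(y) dy` on `ℝ`, the variable of `g` being the
integration variable, as in `truncConv`. -/
noncomputable def conv (f g : ℝ → ℂ) (x : ℝ) : ℂ := ∫ y, f (x - y) * g y

theorem conv_eq_convolution (f g : ℝ → ℂ) :
    conv f g = convolution f g (ContinuousLinearMap.mul ℂ ℂ) volume := by
  ext x
  exact convolution_mul_swap.symm

theorem conv_congr_right {f g g' : ℝ → ℂ} (h : g =ᵐ[volume] g') : conv f g = conv f g' := by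
  ext x
  exact integral_congr_ae (h.mono fun y hy => by simp only [hy])

theorem conv_congr_left {f f' g : ℝ → ℂ} (h : f =ᵐ[volume] f') : conv f g = conv f' g := by
  ext x
  have h2 : ∀ᵐ y, f (x - y) = f' (x - y) :=
    (Measure.measurePreserving_sub_left volume x).quasiMeasurePreserving.ae h
  exact integral_congr_ae (h2.mono fun y hy => by simp only [hy])

theorem aestronglyMeasurable_conv_integrand {f g : ℝ → ℂ} (hf : AEStronglyMeasurable f volume)
    (hg : AEStronglyMeasurable g volume) :
    AEStronglyMeasurable (fun z : ℝ × ℝ => f (z.1 - z.2) * g z.2) (volume.prod volume) := by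
  simpa [mul_comm] using hg.convolution_integrand (ContinuousLinearMap.mul ℂ ℂ) hf

theorem aestronglyMeasurable_conv {f g : ℝ → ℂ} (hf : AEStronglyMeasurable f volume)
    (hg : AEStronglyMeasurable g volume) : AEStronglyMeasurable (conv f g) volume :=
  (aestronglyMeasurable_conv_integrand hf hg).integral_prod_right'

theorem integrable_conv {f g : ℝ → ℂ} (hf : Integrable f) (hg : Integrable g) :
    Integrable (conv f g) := by
  rw [conv_eq_convolution]
  exact hf.integrable_convolution _ hg

theorem ae_integrable_conv_integrand {f g : ℝ → ℂ} (hf : Integrable f) (hg : Integrable g) :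
    ∀ᵐ x, Integrable fun y => f (x - y) * g y := by
  have h := (hg.convolution_integrand (ContinuousLinearMap.mul ℂ ℂ) hf).prod_right_ae
  filter_upwards [h] with x hx
  simpa [mul_comm] using hx

theorem conv_sub_right {f g g' : ℝ → ℂ} (hf : Integrable f) (hg : Integrable g)
    (hg' : Integrable g') : conv f (fun x => g x - g' x) =ᵐ[volume] fun x =>
      conv f g x - conv f g' x := by
  filter_upwards [ae_integrable_conv_integrand hf hg, ae_integrable_conv_integrand hf hg']
    with x h1 h2
  simp only [conv, mul_sub]
  exact integral_sub h1 h2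

theorem lintegral_enorm_conv_le {f g : ℝ → ℂ} (hf : AEStronglyMeasurable f volume)
    (hg : AEStronglyMeasurable g volume) :
    ∫⁻ x, ‖conv f g x‖ₑ ≤ (∫⁻ x, ‖f x‖ₑ) * ∫⁻ x, ‖g x‖ₑ := by
  calc ∫⁻ x, ‖conv f g x‖ₑ ≤ ∫⁻ x, ∫⁻ y, ‖f (x - y) * g y‖ₑ :=
        lintegral_mono fun x => enorm_integral_le_lintegral_enorm _
    _ = ∫⁻ y, ∫⁻ x, ‖f (x - y) * g y‖ₑ :=
        lintegral_lintegral_swap (aestronglyMeasurable_conv_integrand hf hg).enorm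
    _ = ∫⁻ y, (∫⁻ x, ‖f x‖ₑ) * ‖g y‖ₑ := by
        refine lintegral_congr fun y => ?_
        simp only [enorm_mul]
        rw [lintegral_mul_const' _ _ enorm_ne_top,
          lintegral_sub_right_eq_self (fun x => ‖f x‖ₑ) y]
    _ = _ := lintegral_const_mul'' _ hg.enorm

theorem integral_norm_conv_le {f g : ℝ → ℂ} (hf : Integrable f) (hg : Integrable g) :
    ∫ x, ‖conv f g x‖ ≤ (∫ x, ‖f x‖) * ∫ x, ‖g x‖ := by
  have h := lintegral_enorm_conv_le hf.1 hg.1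
  rw [integral_norm_eq_lintegral_enorm (integrable_conv hf hg).1,
    integral_norm_eq_lintegral_enorm hf.1, integral_norm_eq_lintegral_enorm hg.1,
    ← ENNReal.toReal_mul]
  exact ENNReal.toReal_mono (ENNReal.mul_ne_top hf.2.ne hg.2.ne) h

/-- Young's inequality `L² * L¹ ⊆ L²`: by Cauchy–Schwarz for the measure `|g(y)| dy`,
`|f * g|² ≤ ‖g‖₁ (|f|² * |g|)`. -/
theorem lintegral_enorm_conv_sq_le {f g : ℝ → ℂ} (hf : AEStronglyMeasurable f volume)
    (hg : Integrable g) :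
    ∫⁻ x, ‖conv f g x‖ₑ ^ (2 : ℝ) ≤
      (∫⁻ y, ‖g y‖ₑ) * ((∫⁻ x, ‖f x‖ₑ ^ (2 : ℝ)) * ∫⁻ y, ‖g y‖ₑ) := by
  have hsq : ∀ a : ℝ≥0∞, (a ^ (1 / 2 : ℝ)) ^ (2 : ℝ) = a := fun a => by
    rw [← ENNReal.rpow_mul]; norm_num
  have hsq' : ∀ a : ℝ≥0∞, a ^ (1 / 2 : ℝ) * a ^ (1 / 2 : ℝ) = a := fun a => by
    rw [← ENNReal.rpow_add_of_nonneg _ _ (by norm_num) (by norm_num)]; norm_num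
  have hpt : ∀ x, ‖conv f g x‖ₑ ^ (2 : ℝ) ≤
      (∫⁻ y, ‖g y‖ₑ) * ∫⁻ y, ‖f (x - y)‖ₑ ^ (2 : ℝ) * ‖g y‖ₑ := by
    intro x
    have hfx : AEStronglyMeasurable (fun y => f (x - y)) volume :=
      hf.comp_measurePreserving (Measure.measurePreserving_sub_left volume x)
    have h1 : ‖conv f g x‖ₑ ≤
        ∫⁻ y, ((fun y => ‖f (x - y)‖ₑ * ‖g y‖ₑ ^ (1 / 2 : ℝ)) *
          fun y => ‖g y‖ₑ ^ (1 / 2 : ℝ)) y := by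
      refine (enorm_integral_le_lintegral_enorm _).trans (le_of_eq (lintegral_congr fun y => ?_))
      simp only [Pi.mul_apply, enorm_mul, mul_assoc, hsq']
    have h2 := h1.trans (ENNReal.lintegral_mul_le_Lp_mul_Lq volume
      Real.HolderConjugate.two_two (hfx.enorm.mul (hg.1.enorm.pow_const _))
      (hg.1.enorm.pow_const _))
    calc ‖conv f g x‖ₑ ^ (2 : ℝ) ≤ _ := ENNReal.rpow_le_rpow h2 (by norm_num)
      _ = _ := by
        rw [ENNReal.mul_rpow_of_nonneg _ _ (by norm_num), hsq, hsq, mul_comm]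
        simp only [hsq, ENNReal.mul_rpow_of_nonneg _ _ (show (0 : ℝ) ≤ 2 by norm_num)]
  have hmeas : AEMeasurable (fun z : ℝ × ℝ => ‖f (z.1 - z.2)‖ₑ ^ (2 : ℝ) * ‖g z.2‖ₑ)
      (volume.prod volume) := by
    have h1 : AEStronglyMeasurable (fun z : ℝ × ℝ => f (z.1 - z.2)) (volume.prod volume) :=
      hf.comp_quasiMeasurePreserving
        (quasiMeasurePreserving_sub_of_right_invariant volume volume)
    exact (h1.enorm.pow_const _).mul hg.1.comp_snd.enorm
  calc ∫⁻ x, ‖conv f g x‖ₑ ^ (2 : ℝ)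
      ≤ ∫⁻ x, (∫⁻ y, ‖g y‖ₑ) * ∫⁻ y, ‖f (x - y)‖ₑ ^ (2 : ℝ) * ‖g y‖ₑ := lintegral_mono hpt
    _ = (∫⁻ y, ‖g y‖ₑ) * ∫⁻ x, ∫⁻ y, ‖f (x - y)‖ₑ ^ (2 : ℝ) * ‖g y‖ₑ :=
        lintegral_const_mul' _ _ hg.2.ne
    _ = (∫⁻ y, ‖g y‖ₑ) * ∫⁻ y, ∫⁻ x, ‖f (x - y)‖ₑ ^ (2 : ℝ) * ‖g y‖ₑ := by
        rw [lintegral_lintegral_swap hmeas]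
    _ = (∫⁻ y, ‖g y‖ₑ) * ∫⁻ y, (∫⁻ x, ‖f x‖ₑ ^ (2 : ℝ)) * ‖g y‖ₑ := by
        congr 1
        refine lintegral_congr fun y => ?_
        rw [lintegral_mul_const' _ _ enorm_ne_top,
          lintegral_sub_right_eq_self (fun x => ‖f x‖ₑ ^ (2 : ℝ)) y]
    _ = (∫⁻ y, ‖g y‖ₑ) * ((∫⁻ x, ‖f x‖ₑ ^ (2 : ℝ)) * ∫⁻ y, ‖g y‖ₑ) := by
        rw [lintegral_const_mul'' _ hg.1.enorm]

theorem lintegral_enorm_sq_lt_top {f : ℝ → ℂ} (hf : MemLp f 2 volume) :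
    ∫⁻ x, ‖f x‖ₑ ^ (2 : ℝ) < ∞ := by
  have hf2 := hf.2
  rw [eLpNorm_lt_top_iff_lintegral_rpow_enorm_lt_top (by norm_num) (by norm_num)] at hf2
  simpa only [ENNReal.toReal_ofNat] using hf2

theorem memLp_two_conv {f g : ℝ → ℂ} (hf : MemLp f 2 volume) (hg : Integrable g) :
    MemLp (conv f g) 2 volume := by
  refine ⟨aestronglyMeasurable_conv hf.1 hg.1, ?_⟩
  rw [eLpNorm_lt_top_iff_lintegral_rpow_enorm_lt_top (by norm_num) (by norm_num)]
  simp only [ENNReal.toReal_ofNat]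
  exact (lintegral_enorm_conv_sq_le hf.1 hg).trans_lt
    (ENNReal.mul_lt_top hg.2 (ENNReal.mul_lt_top (lintegral_enorm_sq_lt_top hf) hg.2))

theorem integral_norm_sq_eq_toReal {f : ℝ → ℂ} (hf : AEStronglyMeasurable f volume) :
    ∫ x, ‖f x‖ ^ 2 = (∫⁻ x, ‖f x‖ₑ ^ (2 : ℝ)).toReal := by
  rw [integral_eq_lintegral_of_nonneg_ae (Eventually.of_forall fun x => by positivity)
    (f := fun x => ‖f x‖ ^ 2) (hf.norm.pow 2)]
  congr 1
  refine lintegral_congr fun x => ?_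
  rw [ENNReal.ofReal_pow (norm_nonneg _), ofReal_norm, ENNReal.rpow_two]

theorem integral_norm_sq_conv_le {f g : ℝ → ℂ} (hf : MemLp f 2 volume) (hg : Integrable g) :
    ∫ x, ‖conv f g x‖ ^ 2 ≤ (∫ y, ‖g y‖) ^ 2 * ∫ x, ‖f x‖ ^ 2 := by
  have hf2 := lintegral_enorm_sq_lt_top hf
  rw [integral_norm_sq_eq_toReal (aestronglyMeasurable_conv hf.1 hg.1),
    integral_norm_sq_eq_toReal hf.1, integral_norm_eq_lintegral_enorm hg.1]
  refine (ENNReal.toReal_mono (ENNReal.mul_lt_top hg.2 (ENNReal.mul_lt_top hf2 hg.2)).ne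
    (lintegral_enorm_conv_sq_le hf.1 hg)).trans (le_of_eq ?_)
  rw [ENNReal.toReal_mul, ENNReal.toReal_mul]
  ring

theorem conv_comm (f g : ℝ → ℂ) : conv f g = conv g f := by
  ext x
  rw [conv, ← integral_sub_left_eq_self _ volume x]
  simp only [conv, sub_sub_cancel, mul_comm]

/-! ### Truncated Wiener–Hopf equations -/

/-- The a priori estimate `(1 - ‖H‖₁) ‖E‖₁ ≤ ‖F‖₁` for `|E| ≤ F + |H * E|`. -/
theorem integral_norm_le_of_norm_le_add_conv {H E : ℝ → ℂ} {F : ℝ → ℝ} (hH : Integrable H)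
    (hE : Integrable E) (hF : Integrable F)
    (h : ∀ᵐ x, ‖E x‖ ≤ F x + ‖conv H E x‖) :
    (1 - ∫ x, ‖H x‖) * ∫ x, ‖E x‖ ≤ ∫ x, F x := by
  have h1 : ∫ x, ‖E x‖ ≤ ∫ x, (F x + ‖conv H E x‖) :=
    integral_mono_ae hE.norm (hF.add (integrable_conv hH hE).norm) h
  rw [integral_add hF (integrable_conv hH hE).norm] at h1
  linarith [integral_norm_conv_le hH hE]

/-- For `‖H‖₁ < 1` the equation `A + H * A = g` on `S`, with `A` supported on `S`, has a solution
in `L¹`, since `A ↦ 1_S (g - H * A)` is a contraction. -/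
theorem exists_eq_indicator_sub_conv {H g : ℝ → ℂ} (hH : Integrable H) (hH1 : ∫ x, ‖H x‖ < 1)
    (hg : Integrable g) {S : Set ℝ} (hS : MeasurableSet S) :
    ∃ A : ℝ → ℂ, Integrable A ∧ A = S.indicator fun s => g s - conv H A s := by
  have hint : ∀ f : ℝ → ℂ, Integrable f →
      Integrable (S.indicator fun s => g s - conv H f s) := fun f hf =>
    (hg.sub (integrable_conv hH hf)).indicator hS
  let Φ : Lp ℂ 1 (volume : Measure ℝ) → Lp ℂ 1 (volume : Measure ℝ) := fun f =>
    (hint f (L1.integrable_coeFn f)).toL1 _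
  have hΦ : ContractingWith (∫ x, ‖H x‖).toNNReal Φ := by
    refine ⟨by rw [Real.toNNReal_lt_one]; exact hH1, LipschitzWith.of_dist_le_mul fun f f' => ?_⟩
    have hf := L1.integrable_coeFn f
    have hf' := L1.integrable_coeFn f'
    rw [Real.coe_toNNReal _ (integral_nonneg fun _ => norm_nonneg _), dist_eq_norm, dist_eq_norm,
      ← Integrable.toL1_sub, L1.norm_of_fun_eq_integral_norm, L1.norm_eq_integral_norm]
    have hsub : ∫ x, ‖(f - f' : Lp ℂ 1 (volume : Measure ℝ)) x‖ = ∫ x, ‖f x - f' x‖ :=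
      integral_congr_ae ((Lp.coeFn_sub f f').mono fun x hx => by
        simp only [hx, Pi.sub_apply])
    rw [hsub]
    refine le_trans ?_ (integral_norm_conv_le hH (hf.sub hf'))
    refine integral_mono_ae ((hint f hf).sub (hint f' hf')).norm
      (integrable_conv hH (hf.sub hf')).norm ?_
    filter_upwards [conv_sub_right hH hf hf'] with x hx
    by_cases hxS : x ∈ S
    · simp only [Pi.sub_apply, indicator_of_mem hxS]
      rw [hx, ← norm_neg]
      apply le_of_eq
      congr 1
      ring
    · simp [indicator_of_notMem hxS]
  let f := hΦ.fixedPoint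
  have hf := L1.integrable_coeFn f
  refine ⟨S.indicator fun s => g s - conv H f s, hint f hf, ?_⟩
  have hfix : Φ f = f := hΦ.fixedPoint_isFixedPt
  have hae : (S.indicator fun s => g s - conv H f s) =ᵐ[volume] f := by
    have := (hint f hf).coeFn_toL1
    have h2 : ((hint f hf).toL1 _ : Lp ℂ 1 (volume : Measure ℝ)) = f := hfix
    rw [h2] at this
    exact this.symm
  rw [conv_congr_right hae]

/-! ### The Fourier transform on `L¹` -/

/-- The Fourier transform `∫ f(s) e^{-iξs} ds`, in the angular normalization of `accelerantKernel`. -/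
noncomputable def ft (f : ℝ → ℂ) (ξ : ℝ) : ℂ :=
  ∫ s : ℝ, Complex.exp (-(Complex.I * ξ * s)) * f s

theorem ft_eq_fourier (f : ℝ → ℂ) (ξ : ℝ) : ft f ξ = 𝓕 f (ξ / (2 * Real.pi)) := by
  rw [Real.fourier_real_eq_integral_exp_smul]
  refine integral_congr_ae (Eventually.of_forall fun s => ?_)
  simp only [smul_eq_mul]
  congr 2
  push_cast
  have : (Real.pi : ℂ) ≠ 0 := by exact_mod_cast Real.pi_ne_zero
  field_simp

theorem norm_exp_neg_I_mul (ξ s : ℝ) : ‖Complex.exp (-(Complex.I * ξ * s))‖ = 1 := by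
  rw [show -(Complex.I * ξ * s) = ((-(ξ * s) : ℝ) : ℂ) * Complex.I by push_cast; ring,
    Complex.norm_exp_ofReal_mul_I]

theorem integrable_exp_mul {f : ℝ → ℂ} (hf : Integrable f) (ξ : ℝ) :
    Integrable fun s : ℝ => Complex.exp (-(Complex.I * ξ * s)) * f s :=
  hf.bdd_mul (c := 1) (by fun_prop) (Eventually.of_forall fun s => (norm_exp_neg_I_mul ξ s).le)

theorem norm_ft_le (f : ℝ → ℂ) (ξ : ℝ) : ‖ft f ξ‖ ≤ ∫ s, ‖f s‖ := by
  refine (norm_integral_le_integral_norm _).trans (le_of_eq ?_)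
  simp only [norm_mul, norm_exp_neg_I_mul, one_mul]

theorem continuous_ft {f : ℝ → ℂ} (hf : Integrable f) : Continuous (ft f) := by
  refine continuous_of_dominated (fun ξ => (integrable_exp_mul hf ξ).1)
    (fun ξ => Eventually.of_forall fun s => ?_) hf.norm
    (Eventually.of_forall fun s => by fun_prop)
  rw [norm_mul, norm_exp_neg_I_mul, one_mul]

theorem ft_congr {f g : ℝ → ℂ} (h : f =ᵐ[volume] g) : ft f = ft g := by
  ext ξ
  exact integral_congr_ae (h.mono fun s hs => by simp only [hs])

theorem ft_sub {f g : ℝ → ℂ} (hf : Integrable f) (hg : Integrable g) (ξ : ℝ) :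
    ft (fun s => f s - g s) ξ = ft f ξ - ft g ξ := by
  simp only [ft, mul_sub]
  exact integral_sub (integrable_exp_mul hf ξ) (integrable_exp_mul hg ξ)

theorem ft_conv {f g : ℝ → ℂ} (hf : Integrable f) (hg : Integrable g) (ξ : ℝ) :
    ft (conv f g) ξ = ft f ξ * ft g ξ := by
  simp only [ft_eq_fourier, conv_eq_convolution]
  exact Real.fourier_mul_convolution_eq hf hg _

theorem ft_conj_neg (f : ℝ → ℂ) (ξ : ℝ) : ft (fun s => conj (f (-s))) ξ = conj (ft f ξ) := by
  simp only [ft]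
  rw [← integral_conj, ← integral_neg_eq_self]
  refine integral_congr_ae (Eventually.of_forall fun s => ?_)
  simp [← Complex.exp_conj]

theorem integrable_conj_neg {f : ℝ → ℂ} (hf : Integrable f) :
    Integrable fun s => conj (f (-s)) :=
  (Complex.conjLIE.integrable_comp_iff (φ := fun s => f (-s))).2 hf.comp_neg

/-- The Fourier transform is injective on `L¹`: test `f` against Fourier transforms of Schwartz
functions. -/
theorem ae_eq_zero_of_ft_eq_zero {f : ℝ → ℂ} (hf : Integrable f) (h : ∀ ξ, ft f ξ = 0) :
    f =ᵐ[volume] 0 := by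
  have h0 : 𝓕 f = 0 := by
    ext ξ
    have := h (ξ * (2 * Real.pi))
    rw [ft_eq_fourier, mul_div_assoc, div_self (by positivity), mul_one] at this
    exact this
  refine ae_eq_zero_of_integral_contDiff_smul_eq_zero hf.locallyIntegrable fun g hg hgc => ?_
  have hgc' : HasCompactSupport (fun x => (g x : ℂ)) := hgc.comp_left Complex.ofReal_zero
  have hg' : ContDiff ℝ (⊤ : ℕ∞) (fun x => (g x : ℂ)) := Complex.ofRealCLM.contDiff.comp hg
  let φ : SchwartzMap ℝ ℂ := hgc'.toSchwartzMap hg'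
  have hφ : 𝓕 (⇑(𝓕⁻ φ : SchwartzMap ℝ ℂ)) = fun x => (g x : ℂ) := by
    rw [← SchwartzMap.fourier_coe, FourierTransform.fourier_fourierInv_eq]
    rfl
  have := VectorFourier.integral_fourierIntegral_smul_eq_flip (L := innerₗ ℝ) (μ := volume)
    (ν := volume) Real.continuous_fourierChar continuous_inner hf (𝓕⁻ φ : SchwartzMap ℝ ℂ).integrable
  rw [flip_innerₗ] at this
  change ∫ ξ, 𝓕 f ξ • (𝓕⁻ φ : SchwartzMap ℝ ℂ) ξ = ∫ x, f x • 𝓕 (⇑(𝓕⁻ φ : SchwartzMap ℝ ℂ)) x at this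
  rw [h0, hφ] at this
  simp only [Pi.zero_apply, smul_eq_mul, zero_mul, integral_zero] at this
  rw [this]
  refine integral_congr_ae (Eventually.of_forall fun x => ?_)
  simp [mul_comm]

/-! ### The half-line equation and the spectral factorization -/

theorem conv_eq_zero_of_pos {f g : ℝ → ℂ} (hf : ∀ s, 0 < s → f s = 0)
    (hg : ∀ s, 0 < s → g s = 0) {s : ℝ} (hs : 0 < s) : conv f g s = 0 := by
  rw [conv, ← integral_zero ℝ ℂ (μ := volume)]
  refine integral_congr_ae (Eventually.of_forall fun y => ?_)
  rcases le_or_gt y 0 with hy | hy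
  · simp [hf (s - y) (by linarith)]
  · simp [hg y hy]

/-- If `A` solves the Wiener–Hopf equation of the Hermitian kernel `H` on the half-line, then
`(1 + Ĥ) |1 - Â|² = 1`. Indeed `(1 + Ĥ)(1 - Â) = 1 + B̂` with `B` supported on the negative
half-line, so that `(1 + Ĥ) |1 - Â|² - 1` is real and the transform of a function that vanishes on
the positive half-line; a real transform belongs to a Hermitian function, which then vanishes. -/
theorem one_add_ft_mul_normSq {H A : ℝ → ℂ} (hH : Integrable H)
    (hHerm : ∀ x, H (-x) = conj (H x)) (hA : Integrable A)
    (hAeq : A = (Ici 0).indicator fun s => H s - conv H A s) (ξ : ℝ) :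
    (1 + ft H ξ) * (1 - ft A ξ) * conj (1 - ft A ξ) = 1 := by
  have hA0 : ∀ s, s < 0 → A s = 0 := fun s hs => by
    rw [hAeq, indicator_of_notMem (by simpa using hs)]
  set B : ℝ → ℂ := fun s => (H s - conv H A s) - A s with hBdef
  have hHA := integrable_conv hH hA
  have hHHA : Integrable fun s => H s - conv H A s := hH.sub hHA
  have hB : Integrable B := hHHA.sub hA
  have hB0 : ∀ s, 0 < s → B s = 0 := fun s hs => by
    have : A s = H s - conv H A s := by
      conv_lhs => rw [hAeq]
      rw [indicator_of_mem (show s ∈ Ici (0 : ℝ) from hs.le)]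
    simp only [hBdef, this, sub_self]
  have hftB : ∀ ξ, ft B ξ = (1 + ft H ξ) * (1 - ft A ξ) - 1 := fun ξ => by
    rw [hBdef, ft_sub hHHA hA, ft_sub hH hHA, ft_conv hH hA]
    ring
  set A' : ℝ → ℂ := fun s => conj (A (-s)) with hA'def
  have hA' : Integrable A' := integrable_conj_neg hA
  have hA'0 : ∀ s, 0 < s → A' s = 0 := fun s hs => by
    simp only [hA'def, hA0 (-s) (by linarith), map_zero]
  have hBA' := integrable_conv hB hA'
  set D : ℝ → ℂ := fun s => (B s - A' s) - conv B A' s with hDdef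
  have hBsA' : Integrable fun s => B s - A' s := hB.sub hA'
  have hD : Integrable D := hBsA'.sub hBA'
  have hftD : ∀ ξ, ft D ξ = (1 + ft H ξ) * (1 - ft A ξ) * conj (1 - ft A ξ) - 1 := fun ξ => by
    rw [hDdef, ft_sub hBsA' hBA', ft_sub hB hA', ft_conv hB hA', hftB, hA'def, ft_conj_neg,
      map_sub, map_one]
    ring
  have hD0 : ∀ s, 0 < s → D s = 0 := fun s hs => by
    simp only [hDdef, hB0 s hs, hA'0 s hs, conv_eq_zero_of_pos hB0 hA'0 hs, sub_zero]
  have hHreal : ∀ ξ, conj (ft H ξ) = ft H ξ := fun ξ => by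
    rw [← ft_conj_neg]
    congr 1
    ext s
    rw [hHerm, Complex.conj_conj]
  have hsym : (fun s => D s - conj (D (-s))) =ᵐ[volume] 0 := by
    refine ae_eq_zero_of_ft_eq_zero (hD.sub (integrable_conj_neg hD)) fun ξ => ?_
    rw [ft_sub hD (integrable_conj_neg hD), ft_conj_neg, hftD]
    simp only [map_sub, map_mul, map_add, map_one, hHreal, Complex.conj_conj]
    ring
  have hDz : D =ᵐ[volume] 0 := by
    have h0 : ∀ᵐ s : ℝ, s ≠ 0 := by simp [ae_iff, measure_singleton]
    filter_upwards [hsym, h0] with s hs hs0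
    rcases lt_or_gt_of_ne hs0 with h | h
    · have := hD0 (-s) (by linarith)
      simpa [this] using hs
    · exact hD0 s h
  have := hftD ξ
  rw [ft_congr hDz] at this
  have h0 : ft 0 ξ = 0 := by simp [ft]
  rw [h0] at this
  linear_combination -this

/-! ### Positivity and resolvent kernels -/

/-- A real even function in `L¹ ∩ L²` with `‖H‖₁ < 1`: the accelerants for which the truncated
convolution operators are contractions, on `L¹` and on `L²`. -/
structure IsSmallKernel (H : ℝ → ℂ) : Prop where
  integrable : Integrable H
  memLp_two : MemLp H 2 volume
  even : ∀ x, H (-x) = H x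
  real : ∀ x, conj (H x) = H x
  norm_lt : ∫ x, ‖H x‖ < 1

theorem truncConv_eq_conv_indicator (H f : ℝ → ℂ) {r : ℝ} (hr : 0 ≤ r) (x : ℝ) :
    truncConv H r f x = conv H ((Icc 0 r).indicator f) x := by
  rw [truncConv, conv, intervalIntegral.integral_of_le hr, ← integral_Icc_eq_integral_Ioc,
    ← integral_indicator measurableSet_Icc]
  refine integral_congr_ae (Eventually.of_forall fun y => ?_)
  by_cases hy : y ∈ Icc 0 r <;> simp [hy]

theorem integrable_indicator_Icc_of_memLp_two {f : ℝ → ℂ} {r : ℝ}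
    (hf : MemLp f 2 (volume.restrict (Icc 0 r))) : Integrable ((Icc 0 r).indicator f) := by
  rw [integrable_indicator_iff measurableSet_Icc]
  exact hf.integrable (by norm_num)

/-- `I + 𝓗_r > 0` because `𝓗_r` is a contraction of `L²([0,r])`:
`Re ⟨f + 𝓗_r f, f⟩ ≥ ½ (1 - ‖H‖₁²) ‖f‖₂²`. -/
theorem IsSmallKernel.isPositive {H : ℝ → ℂ} (hH : IsSmallKernel H) {r : ℝ} (hr : 0 < r) :
    IsPositive H r := by
  intro f hf hf0
  set F : ℝ → ℂ := (Icc 0 r).indicator f with hFdef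
  have hF1 : Integrable F := integrable_indicator_Icc_of_memLp_two hf
  have hF2 : MemLp F 2 volume := (memLp_indicator_iff_restrict measurableSet_Icc).2 hf
  have hC : MemLp (conv H F) 2 volume := memLp_two_conv hH.memLp_two hF1
  have hCle : ∫ x, ‖conv H F x‖ ^ 2 ≤ (∫ y, ‖H y‖) ^ 2 * ∫ x, ‖F x‖ ^ 2 := by
    rw [conv_comm]
    exact integral_norm_sq_conv_le hF2 hH.integrable
  have hFsq : Integrable fun x => ‖F x‖ ^ 2 := (memLp_two_iff_integrable_sq_norm hF2.1).1 hF2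
  have hCsq : Integrable fun x => ‖conv H F x‖ ^ 2 :=
    (memLp_two_iff_integrable_sq_norm hC.1).1 hC
  have hpos : 0 < ∫ x, ‖F x‖ ^ 2 := by
    rw [integral_pos_iff_support_of_nonneg (fun x => by positivity) hFsq, pos_iff_ne_zero]
    intro h0
    apply hf0
    have h1 : F =ᵐ[volume] 0 := by
      rw [Filter.EventuallyEq, ae_iff]
      refine measure_mono_null (fun x hx => ?_) h0
      simpa using hx
    exact (indicator_ae_eq_restrict measurableSet_Icc).symm.trans (ae_restrict_of_ae h1)
  have hint : Integrable fun x => (F x + conv H F x) * conj (F x) :=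
    (hF2.add hC).integrable_mul (q := 2) (p := 2) hF2.star
  have heq : ∫ x in (0 : ℝ)..r, (f x + truncConv H r f x) * conj (f x) =
      ∫ x, (F x + conv H F x) * conj (F x) := by
    rw [intervalIntegral.integral_of_le hr.le, ← integral_Icc_eq_integral_Ioc,
      ← integral_indicator measurableSet_Icc]
    refine integral_congr_ae (Eventually.of_forall fun x => ?_)
    by_cases hx : x ∈ Icc 0 r
    · simp only [indicator_of_mem hx, truncConv_eq_conv_indicator H f hr.le, hFdef]
    · simp only [indicator_of_notMem hx, hFdef, map_zero, mul_zero]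
  rw [heq]
  have hre : (∫ x, (F x + conv H F x) * conj (F x)).re =
      ∫ x, ((F x + conv H F x) * conj (F x)).re :=
    (integral_re hint).symm
  rw [hre]
  have hle : ∫ x, (‖F x‖ ^ 2 / 2 - ‖conv H F x‖ ^ 2 / 2) ≤
      ∫ x, ((F x + conv H F x) * conj (F x)).re := by
    refine integral_mono ((hFsq.div_const 2).sub (hCsq.div_const 2)) hint.re fun x => ?_
    have h1 : |(conv H F x * conj (F x)).re| ≤ ‖conv H F x‖ * ‖F x‖ := by
      refine (Complex.abs_re_le_norm _).trans (le_of_eq ?_)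
      rw [norm_mul, RCLike.norm_conj]
    have h2 : ((F x + conv H F x) * conj (F x)).re =
        ‖F x‖ ^ 2 + (conv H F x * conj (F x)).re := by
      rw [add_mul, Complex.mul_conj, Complex.add_re, Complex.ofReal_re, Complex.normSq_eq_norm_sq]
    simp only [h2]
    nlinarith [abs_le.1 h1, sq_nonneg (‖conv H F x‖ - ‖F x‖)]
  refine lt_of_lt_of_le ?_ hle
  rw [integral_sub (hFsq.div_const 2) (hCsq.div_const 2), integral_div, integral_div]
  have h0 : 0 ≤ ∫ y, ‖H y‖ := integral_nonneg fun _ => norm_nonneg _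
  have h1 : (∫ y, ‖H y‖) ^ 2 < 1 := by nlinarith [hH.norm_lt]
  nlinarith

theorem IsSmallKernel.exists_isResolventKernel {H : ℝ → ℂ} (hH : IsSmallKernel H) {r : ℝ}
    (hr : 0 ≤ r) : ∃ Γ : ℝ → ℝ → ℂ, IsResolventKernel H r Γ := by
  have hg : ∀ t : ℝ, Integrable fun s => H (t - s) := fun t => hH.integrable.comp_sub_left t
  choose Γ hΓ1 hΓ2 using fun t : ℝ => exists_eq_indicator_sub_conv hH.integrable hH.norm_lt (hg t)
    (measurableSet_Icc (a := (0 : ℝ)) (b := r))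
  refine ⟨Γ, ⟨fun t _ => ?_, fun t _ => ?_⟩⟩
  · have h1 : MemLp (fun s => H (t - s)) 2 volume :=
      hH.memLp_two.comp_measurePreserving (Measure.measurePreserving_sub_left volume t)
    have h2 := (h1.sub (memLp_two_conv hH.memLp_two (hΓ1 t))).indicator
      (measurableSet_Icc (a := (0 : ℝ)) (b := r))
    rw [hΓ2 t]
    exact h2.restrict _
  · refine (ae_restrict_iff' measurableSet_Icc).2 (Eventually.of_forall fun s hs => ?_)
    have hind : (Icc 0 r).indicator (Γ t) = Γ t := by
      rw [hΓ2 t, indicator_indicator, inter_self]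
    have h1 : ∫ u in (0 : ℝ)..r, Γ t u * H (u - s) = conv H (Γ t) s := by
      rw [← hind, ← truncConv_eq_conv_indicator H (Γ t) hr s, truncConv]
      congr 1
      ext u
      rw [hind, ← hH.even (u - s), neg_sub, mul_comm]
    have h2 : Γ t s = H (t - s) - conv H (Γ t) s := by
      conv_lhs => rw [hΓ2 t]
      rw [indicator_of_mem hs]
    rw [h1, h2, sub_add_cancel]

/-- The row `t = r` of a resolvent kernel, reflected to `A(s) = Γ_r(r, r - s)`, solves the
Wiener–Hopf equation truncated to `[0, r]`. -/
theorem exists_truncated_of_isResolventKernel {H H' : ℝ → ℂ} (hHH' : H' =ᵐ[volume] H)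
    {r : ℝ} (hr : 0 ≤ r) {Γ : ℝ → ℝ → ℂ}
    (hΓ : IsResolventKernel H' r Γ) :
    ∃ A : ℝ → ℂ, Integrable A ∧
      A =ᵐ[volume] (Icc 0 r).indicator (fun s => H s - conv H A s) ∧
      ∀ ξ : ℝ, ∫ t in (0 : ℝ)..r, Γ r t * Complex.exp (Complex.I * ξ * t) =
        Complex.exp (Complex.I * ξ * r) * ft A ξ := by
  set G : ℝ → ℂ := (Icc 0 r).indicator (Γ r) with hG
  have hGint : Integrable G :=
    integrable_indicator_Icc_of_memLp_two (hΓ.memLp r (right_mem_Icc.2 hr))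
  have hmem : ∀ s, r - s ∈ Icc 0 r ↔ s ∈ Icc 0 r := fun s => by
    simp only [mem_Icc]
    constructor <;> rintro ⟨h1, h2⟩ <;> constructor <;> linarith
  refine ⟨fun s => G (r - s), hGint.comp_sub_left r, ?_, fun ξ => ?_⟩
  · have hres := (ae_restrict_iff' measurableSet_Icc).1 (hΓ.resolvent r (right_mem_Icc.2 hr))
    have hmp := (Measure.measurePreserving_sub_left volume r).quasiMeasurePreserving
    filter_upwards [hmp.ae hres, hHH'] with s hs hs'
    by_cases hsI : s ∈ Icc 0 r
    · have h1 := hs ((hmem s).2 hsI)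
      have h2 : ∫ u in (0 : ℝ)..r, Γ r u * H' (u - (r - s)) =
          conv H (fun s => G (r - s)) s := by
        rw [← conv_congr_left hHH', conv_comm, conv, intervalIntegral.integral_of_le hr,
          ← integral_Icc_eq_integral_Ioc, ← integral_indicator measurableSet_Icc,
          ← integral_add_right_eq_self _ (r - s)]
        refine integral_congr_ae (Eventually.of_forall fun y => ?_)
        have h3 : r - (s - y) = y + (r - s) := by ring
        by_cases hy : y + (r - s) ∈ Icc 0 r <;> simp [hG, h3, hy]
      rw [h2, sub_sub_cancel, hs'] at h1
      rw [indicator_of_mem hsI, ← h1, hG, indicator_of_mem ((hmem s).2 hsI)]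
      ring
    · rw [indicator_of_notMem hsI, hG, indicator_of_notMem (mt (hmem s).1 hsI)]
  · rw [intervalIntegral.integral_of_le hr, ← integral_Icc_eq_integral_Ioc,
      ← integral_indicator measurableSet_Icc, ← integral_sub_left_eq_self _ volume r, ft,
      ← integral_const_mul]
    refine integral_congr_ae (Eventually.of_forall fun s => ?_)
    by_cases hs : r - s ∈ Icc 0 r
    · simp only [indicator_of_mem hs, hG, ← mul_assoc, ← Complex.exp_add]
      rw [mul_comm]
      congr 2
      push_cast
      ring
    · simp only [indicator_of_notMem hs, hG, mul_zero]

/-- The solutions `A` on `T` and `A'` on `S ⊆ T` of the truncated Wiener–Hopf equation differ in `L¹`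
by at most the mass of `A` outside `S`, up to the factor `(1 - ‖H‖₁)⁻¹`. For `S = T` this is
uniqueness. -/
theorem IsSmallKernel.integral_norm_sub_le {H : ℝ → ℂ} (hH : IsSmallKernel H) {S T : Set ℝ}
    (hS : MeasurableSet S) (hST : S ⊆ T) {A A' : ℝ → ℂ} (hA : Integrable A)
    (hA' : Integrable A')
    (hAeq : A =ᵐ[volume] T.indicator fun s => H s - conv H A s)
    (hA'eq : A' =ᵐ[volume] S.indicator fun s => H s - conv H A' s) :
    (1 - ∫ x, ‖H x‖) * ∫ x, ‖A x - A' x‖ ≤ ∫ x, Sᶜ.indicator (fun x => ‖A x‖) x := by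
  refine integral_norm_le_of_norm_le_add_conv hH.integrable (hA.sub hA')
    (hA.norm.indicator hS.compl) ?_
  filter_upwards [hAeq, hA'eq, conv_sub_right hH.integrable hA hA'] with x h1 h2 h3
  have h3' : conv H (fun x => A x - A' x) x = conv H A x - conv H A' x := h3
  by_cases hx : x ∈ S
  · rw [indicator_of_mem (hST hx)] at h1
    rw [indicator_of_mem hx] at h2
    rw [indicator_of_notMem (by simpa using hx), h3', h1, h2, zero_add, ← norm_neg]
    apply le_of_eq
    congr 1
    ring
  · rw [indicator_of_notMem hx] at h2
    rw [indicator_of_mem (show x ∈ Sᶜ from hx), h2, sub_zero]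
    exact le_add_of_nonneg_right (norm_nonneg _)

theorem IsSmallKernel.ft_eq_of_truncated {H : ℝ → ℂ} (hH : IsSmallKernel H) {S : Set ℝ}
    (hS : MeasurableSet S) {A A' : ℝ → ℂ} (hA : Integrable A) (hA' : Integrable A')
    (hAeq : A =ᵐ[volume] S.indicator fun s => H s - conv H A s)
    (hA'eq : A' =ᵐ[volume] S.indicator fun s => H s - conv H A' s) : ft A = ft A' := by
  have h := hH.integral_norm_sub_le hS subset_rfl hA hA' hAeq hA'eq
  have h0 : ∫ x, Sᶜ.indicator (fun x => ‖A x‖) x = 0 := by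
    rw [← integral_zero ℝ ℝ (μ := volume)]
    refine integral_congr_ae (hAeq.mono fun x hx => ?_)
    by_cases hxS : x ∈ S
    · simp [hxS]
    · simp [hx, hxS]
  rw [h0] at h
  have h1 := hH.norm_lt
  have h2 : 0 ≤ ∫ x, ‖A x - A' x‖ := integral_nonneg fun _ => norm_nonneg _
  ext ξ
  rw [← sub_eq_zero, ← ft_sub hA hA', ← norm_le_zero_iff]
  refine (norm_ft_le _ ξ).trans ?_
  by_contra! hlt
  nlinarith

/-- As `r → ∞` the solutions of the equation truncated to `[0, r]` converge in `L¹`, hence their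
Fourier transforms converge pointwise, to those of the half-line equation. -/
theorem IsSmallKernel.tendsto_ft {H : ℝ → ℂ} (hH : IsSmallKernel H) {A : ℝ → ℂ}
    (hA : Integrable A) (hAeq : A =ᵐ[volume] (Ici 0).indicator fun s => H s - conv H A s)
    {B : ℕ → ℝ → ℂ} (hB : ∀ n, Integrable (B n))
    (hBeq : ∀ n : ℕ, B n =ᵐ[volume] (Icc 0 (n : ℝ)).indicator fun s => H s - conv H (B n) s)
    (ξ : ℝ) : Tendsto (fun n => ft (B n) ξ) atTop (𝓝 (ft A ξ)) := by
  have htail : Tendsto (fun n : ℕ => ∫ x, (Icc 0 (n : ℝ))ᶜ.indicator (fun x => ‖A x‖) x) atTop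
      (𝓝 0) := by
    rw [show 𝓝 (0 : ℝ) = 𝓝 (∫ _ : ℝ, (0 : ℝ)) by rw [integral_zero]]
    refine tendsto_integral_of_dominated_convergence (fun x => ‖A x‖)
      (fun n => (hA.norm.indicator measurableSet_Icc.compl).1) hA.norm
      (fun n => Eventually.of_forall fun x => ?_) ?_
    · by_cases hx : x ∈ (Icc 0 (n : ℝ))ᶜ
      · simp [indicator_of_mem hx]
      · simp [indicator_of_notMem hx]
    · filter_upwards [hAeq] with x hx
      rcases lt_or_ge x 0 with h0 | h0
      · have hAx : A x = 0 := by rw [hx, indicator_of_notMem (by simpa using h0)]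
        have : ∀ n : ℕ, (Icc 0 (n : ℝ))ᶜ.indicator (fun x => ‖A x‖) x = 0 := fun n => by
          by_cases hx : x ∈ (Icc 0 (n : ℝ))ᶜ
          · rw [indicator_of_mem hx, hAx, norm_zero]
          · rw [indicator_of_notMem hx]
        simp only [this, tendsto_const_nhds]
      · obtain ⟨N, hN⟩ := exists_nat_ge x
        refine tendsto_const_nhds.congr' ?_
        filter_upwards [eventually_ge_atTop N] with n hn
        rw [indicator_of_notMem]
        rw [notMem_compl_iff]
        exact ⟨h0, hN.trans (by exact_mod_cast hn)⟩
  have hpos : 0 < 1 - ∫ x, ‖H x‖ := by linarith [hH.norm_lt]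
  rw [tendsto_iff_norm_sub_tendsto_zero]
  refine squeeze_zero (fun n => norm_nonneg _) (fun n => ?_)
    (by simpa using htail.const_mul (1 - ∫ x, ‖H x‖)⁻¹)
  rw [← norm_neg, neg_sub, ← ft_sub hA (hB n), inv_mul_eq_div, le_div_iff₀' hpos]
  refine le_trans ?_ (hH.integral_norm_sub_le measurableSet_Icc Icc_subset_Ici_self hA (hB n)
    hAeq (hBeq n))
  exact mul_le_mul_of_nonneg_left (norm_ft_le _ ξ) hpos.le

/-! ### The accelerant equation -/

/-- The odd function `sgn(s) e^{-|s|}`. -/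
noncomputable def oddExp (s : ℝ) : ℂ :=
  (Ioi 0).indicator (fun s : ℝ => Complex.exp (-1 * s)) s -
    (Iic 0).indicator (fun s : ℝ => Complex.exp (1 * s)) s

/-- The function of `s` whose Fourier transform, at `-ξ`, is `accelerantKernel x ξ`, for `x ≥ 0`. -/
noncomputable def accelerantDual (x s : ℝ) : ℂ :=
  (Ioc 0 x).indicator (fun s : ℝ => ((x - s : ℝ) : ℂ)) s - (x / 2 : ℂ) * oddExp s

theorem integrable_oddExp : Integrable oddExp := by
  refine Integrable.sub ?_ ?_
  · rw [integrable_indicator_iff measurableSet_Ioi]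
    exact integrableOn_exp_mul_complex_Ioi (by simp) 0
  · rw [integrable_indicator_iff measurableSet_Iic]
    exact integrableOn_exp_mul_complex_Iic (by simp) 0

theorem integrable_indicator_sub (x : ℝ) :
    Integrable ((Ioc 0 x).indicator fun s : ℝ => ((x - s : ℝ) : ℂ)) := by
  rw [integrable_indicator_iff measurableSet_Ioc]
  exact (Continuous.integrableOn_Icc (by fun_prop)).mono_set Ioc_subset_Icc_self

theorem integrable_accelerantDual (x : ℝ) : Integrable (accelerantDual x) :=
  (integrable_indicator_sub x).sub (integrable_oddExp.const_mul _)

theorem continuousAt_accelerantDual {x s : ℝ} (hs0 : s ≠ 0) (hsx : s ≠ x) :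
    ContinuousAt (accelerantDual x) s := by
  have hind : ∀ {S : Set ℝ} {f : ℝ → ℂ}, Continuous f → s ∉ frontier S →
      ContinuousAt (S.indicator f) s := fun hf h =>
    hf.continuousOn.continuousAt_indicator h
  refine ContinuousAt.sub (hind (by fun_prop) ?_) (continuousAt_const.mul
    (ContinuousAt.sub (hind (by fun_prop) ?_) (hind (by fun_prop) ?_)))
  · rcases lt_or_ge 0 x with h | h
    · rw [frontier_Ioc h]
      simp [hs0, hsx]
    · simp [Ioc_eq_empty (not_lt.2 h)]
  · simpa [frontier_Ioi] using hs0
  · simpa [frontier_Iic] using hs0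

theorem ft_oddExp (ξ : ℝ) : ft oddExp (-ξ) = 2 * Complex.I * ξ / (1 + (ξ : ℂ) ^ 2) := by
  have h1 : ∀ s : ℝ, Complex.exp (-(Complex.I * (-ξ : ℝ) * s)) * oddExp s =
      (Ioi 0).indicator (fun s : ℝ => Complex.exp ((-1 + Complex.I * ξ) * s)) s -
      (Iic 0).indicator (fun s : ℝ => Complex.exp ((1 + Complex.I * ξ) * s)) s := by
    intro s
    rcases le_or_gt s 0 with h | h
    · have h1 : s ∉ Ioi (0 : ℝ) := by simpa using h
      have h2 : s ∈ Iic (0 : ℝ) := h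
      simp only [oddExp, indicator_of_mem h2, indicator_of_notMem h1, zero_sub, mul_neg,
        ← Complex.exp_add]
      congr 2
      push_cast
      ring
    · have h1 : s ∈ Ioi (0 : ℝ) := h
      have h2 : s ∉ Iic (0 : ℝ) := by simpa using h
      simp only [oddExp, indicator_of_mem h1, indicator_of_notMem h2, sub_zero,
        ← Complex.exp_add]
      congr 1
      push_cast
      ring
  have hre1 : (-1 + Complex.I * ξ).re < 0 := by simp
  have hre2 : 0 < (1 + Complex.I * ξ).re := by simp
  simp only [ft, h1]
  rw [integral_sub, integral_indicator measurableSet_Ioi, integral_indicator measurableSet_Iic,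
    integral_exp_mul_complex_Ioi hre1, integral_exp_mul_complex_Iic hre2]
  · have hn1 : (-1 + Complex.I * ξ) ≠ 0 := fun h => by simp [h] at hre1
    have hn2 : (1 + Complex.I * ξ) ≠ 0 := fun h => by simp [h] at hre2
    have hn3 : (1 + (ξ : ℂ) ^ 2) ≠ 0 := by
      have : (0 : ℝ) < 1 + ξ ^ 2 := by positivity
      exact_mod_cast this.ne'
    simp only [Complex.ofReal_zero, mul_zero, Complex.exp_zero]
    field_simp
    linear_combination (-2 * Complex.I * (ξ : ℂ) ^ 3) * Complex.I_sq
  · rw [integrable_indicator_iff measurableSet_Ioi]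
    exact integrableOn_exp_mul_complex_Ioi hre1 0
  · rw [integrable_indicator_iff measurableSet_Iic]
    exact integrableOn_exp_mul_complex_Iic hre2 0

theorem ft_indicator_sub {x : ℝ} (hx : 0 ≤ x) {ξ : ℝ} (hξ : ξ ≠ 0) :
    ft ((Ioc 0 x).indicator fun s : ℝ => ((x - s : ℝ) : ℂ)) (-ξ) =
      (1 + Complex.I * ξ * x - Complex.exp (Complex.I * ξ * x)) / (ξ : ℂ) ^ 2 := by
  have hξ' : (ξ : ℂ) ≠ 0 := by exact_mod_cast hξ
  have hc : Complex.I * ξ ≠ 0 := mul_ne_zero Complex.I_ne_zero hξ'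
  have h1 : ft ((Ioc 0 x).indicator fun s : ℝ => ((x - s : ℝ) : ℂ)) (-ξ) =
      ∫ s in (0 : ℝ)..x, Complex.exp (Complex.I * ξ * s) * (x - s) := by
    rw [intervalIntegral.integral_of_le hx, ← integral_indicator measurableSet_Ioc, ft]
    refine integral_congr_ae (Eventually.of_forall fun s => ?_)
    by_cases hs : s ∈ Ioc 0 x <;> simp [hs]
  have hderiv : ∀ s : ℝ, HasDerivAt (fun s : ℝ => Complex.exp (Complex.I * ξ * s) *
      ((x - s) / (Complex.I * ξ) + 1 / (Complex.I * ξ) ^ 2))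
      (Complex.exp (Complex.I * ξ * s) * (x - s)) s := by
    intro s
    have h2 : HasDerivAt (fun s : ℝ => Complex.exp (Complex.I * ξ * s))
        (Complex.exp (Complex.I * ξ * s) * (Complex.I * ξ * 1)) s :=
      ((hasDerivAt_id s).ofReal_comp.const_mul (Complex.I * (ξ : ℂ))).cexp
    have h3 : HasDerivAt (fun s : ℝ => ((x : ℂ) - s) / (Complex.I * ξ) + 1 / (Complex.I * ξ) ^ 2)
        (-1 / (Complex.I * ξ)) s :=
      (((hasDerivAt_id s).ofReal_comp.const_sub (x : ℂ)).div_const _).add_const _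
    refine (h2.mul h3).congr_deriv ?_
    field_simp
    ring
  rw [h1, intervalIntegral.integral_eq_sub_of_hasDerivAt (fun s _ => hderiv s)
    (Continuous.intervalIntegrable (by fun_prop) _ _)]
  simp only [Complex.ofReal_zero, mul_zero, Complex.exp_zero, sub_self, zero_div, sub_zero]
  field_simp
  simp only [Complex.I_sq]
  ring

theorem ft_accelerantDual {x : ℝ} (hx : 0 ≤ x) {ξ : ℝ} (hξ : ξ ≠ 0) :
    ft (accelerantDual x) (-ξ) = accelerantKernel x ξ := by
  have hξ' : (ξ : ℂ) ≠ 0 := by exact_mod_cast hξ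
  have hn3 : (1 + (ξ : ℂ) ^ 2) ≠ 0 := by
    have : (0 : ℝ) < 1 + ξ ^ 2 := by positivity
    exact_mod_cast this.ne'
  have h2 : ft (fun s => (x / 2 : ℂ) * oddExp s) (-ξ) = (x / 2 : ℂ) * ft oddExp (-ξ) := by
    simp only [ft]
    rw [← integral_const_mul]
    congr 1
    ext s
    ring
  have h1 : accelerantDual x = fun s => (Ioc 0 x).indicator (fun s : ℝ => ((x - s : ℝ) : ℂ)) s -
    (x / 2 : ℂ) * oddExp s := rfl
  rw [h1, ft_sub (integrable_indicator_sub x) (integrable_oddExp.const_mul _), h2, ft_oddExp,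
    ft_indicator_sub hx hξ, accelerantKernel, if_neg hξ]
  field_simp
  ring

/-- Near `ξ = 0`, where the two orders of vanishing of the numerator matter, the bound comes from the
kernel being a Fourier transform. -/
theorem norm_accelerantKernel_le {x : ℝ} (hx : 0 ≤ x) {ξ : ℝ} (hξ : ξ ≠ 0) :
    ‖accelerantKernel x ξ‖ ≤ ((∫ s, ‖accelerantDual x s‖) + (2 + x)) * (1 + ξ ^ 2)⁻¹ := by
  have h1 : ‖accelerantKernel x ξ‖ ≤ ∫ s, ‖accelerantDual x s‖ := by
    rw [← ft_accelerantDual hx hξ]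
    exact norm_ft_le _ _
  have h2 : ‖accelerantKernel x ξ‖ * ξ ^ 2 ≤ 2 + x := by
    have hexp : ‖Complex.exp (Complex.I * ξ * x)‖ = 1 := by
      have := norm_exp_neg_I_mul (-ξ) x
      simpa using this
    have hmid : ‖Complex.I * ξ * x / (1 + (ξ : ℂ) ^ 2)‖ ≤ x := by
      have hn : ‖(1 + (ξ : ℂ) ^ 2)‖ = 1 + ξ ^ 2 := by
        rw [show (1 + (ξ : ℂ) ^ 2) = ((1 + ξ ^ 2 : ℝ) : ℂ) by push_cast; ring, Complex.norm_real,
          Real.norm_of_nonneg (by positivity)]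
      rw [norm_div, norm_mul, norm_mul, Complex.norm_I, one_mul, hn, Complex.norm_real,
        Complex.norm_real, Real.norm_eq_abs, Real.norm_of_nonneg hx,
        div_le_iff₀ (by positivity)]
      nlinarith [sq_nonneg (|ξ| - 1), sq_abs ξ, abs_nonneg ξ]
    have hnum : ‖1 + Complex.I * ξ * x / (1 + (ξ : ℂ) ^ 2) - Complex.exp (Complex.I * ξ * x)‖ ≤
        2 + x := by
      refine (norm_sub_le _ _).trans ?_
      have := norm_add_le (1 : ℂ) (Complex.I * ξ * x / (1 + (ξ : ℂ) ^ 2))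
      rw [norm_one] at this
      linarith
    have hpos : 0 < ξ ^ 2 := by positivity
    rw [accelerantKernel, if_neg hξ, norm_div, norm_pow, Complex.norm_real, Real.norm_eq_abs,
      sq_abs, div_mul_cancel₀ _ hpos.ne']
    exact hnum
  rw [← div_eq_mul_inv, le_div_iff₀ (by positivity)]
  linarith

theorem ae_ne_zero : ∀ᵐ ξ : ℝ, ξ ≠ 0 := by simp [ae_iff, measure_singleton]

theorem measurable_accelerantKernel (x : ℝ) : Measurable (accelerantKernel x) := by
  unfold accelerantKernel
  refine Measurable.ite (measurableSet_eq_fun measurable_id measurable_const) measurable_const ?_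
  fun_prop

theorem integrable_accelerantKernel {x : ℝ} (hx : 0 ≤ x) : Integrable (accelerantKernel x) :=
  (integrable_inv_one_add_sq.const_mul _).mono' (measurable_accelerantKernel x).aestronglyMeasurable
    (ae_ne_zero.mono fun _ hξ => norm_accelerantKernel_le hx hξ)

/-- Parseval's identity for `H` and the kernel of the accelerant equation. -/
theorem integral_mul_accelerantDual {H : ℝ → ℂ} (hH : Integrable H) {x : ℝ} (hx : 0 ≤ x) :
    ∫ s, H s * accelerantDual x s =
      (2 * Real.pi : ℂ)⁻¹ * ∫ ξ, ft H ξ * accelerantKernel x ξ := by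
  have hpi : (0 : ℝ) < 2 * Real.pi := by positivity
  have hk := integrable_accelerantDual x
  have hFk : ∀ᵐ v : ℝ, 𝓕 (accelerantDual x) (-v) = accelerantKernel x (v * (2 * Real.pi)) := by
    filter_upwards [ae_ne_zero] with v hv
    rw [← ft_accelerantDual hx (mul_ne_zero hv hpi.ne'), ft_eq_fourier, neg_div,
      mul_div_cancel_right₀ _ hpi.ne']
  have hFint' : Integrable fun v => 𝓕 (accelerantDual x) (-v) :=
    ((integrable_accelerantKernel hx).comp_mul_right' hpi.ne').congr
      (hFk.mono fun v hv => hv.symm)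
  have hFint : Integrable (𝓕 (accelerantDual x)) := by simpa using hFint'.comp_neg
  have hinv : ∀ᵐ s : ℝ, accelerantDual x s = 𝓕 (fun v => 𝓕 (accelerantDual x) (-v)) s := by
    have hnx : ∀ᵐ s : ℝ, s ≠ x := by simp [ae_iff, measure_singleton]
    filter_upwards [ae_ne_zero, hnx] with s h0 h1
    rw [← Real.fourierInv_eq_fourier_comp_neg]
    exact (hk.fourierInv_fourier_eq hFint (continuousAt_accelerantDual h0 h1)).symm
  have hflip := VectorFourier.integral_fourierIntegral_smul_eq_flip (L := innerₗ ℝ) (μ := volume)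
    (ν := volume) Real.continuous_fourierChar continuous_inner hH hFint'
  rw [flip_innerₗ] at hflip
  change ∫ v, 𝓕 H v • 𝓕 (accelerantDual x) (-v) =
    ∫ s, H s • 𝓕 (fun v => 𝓕 (accelerantDual x) (-v)) s at hflip
  simp only [smul_eq_mul] at hflip
  have h1 : ∫ s, H s * accelerantDual x s =
      ∫ s, H s * 𝓕 (fun v => 𝓕 (accelerantDual x) (-v)) s :=
    integral_congr_ae (hinv.mono fun s hs => by simp only [← hs])
  have h2 : ∫ v, 𝓕 H v * 𝓕 (accelerantDual x) (-v) =
      ∫ v, (fun ξ => ft H ξ * accelerantKernel x ξ) (v * (2 * Real.pi)) := by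
    refine integral_congr_ae (hFk.mono fun v hv => ?_)
    simp only [hv, ft_eq_fourier]
    rw [mul_div_cancel_right₀ _ hpi.ne']
  rw [h1, ← hflip, h2, Measure.integral_comp_mul_right (fun ξ => ft H ξ * accelerantKernel x ξ),
    abs_of_pos (by positivity),
    Complex.real_smul]
  push_cast
  rfl

theorem ft_neg_of_even {H : ℝ → ℂ} (hH : ∀ x, H (-x) = H x) (ξ : ℝ) : ft H (-ξ) = ft H ξ := by
  rw [ft, ← integral_neg_eq_self, ft]
  refine integral_congr_ae (Eventually.of_forall fun s => ?_)
  simp [hH]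

theorem integral_mul_oddExp_of_even {H : ℝ → ℂ} (hH : ∀ x, H (-x) = H x) :
    ∫ s, H s * oddExp s = 0 := by
  have h1 : ∫ s, H (-s) * oddExp (-s) = ∫ s, H s * oddExp s :=
    integral_neg_eq_self (fun s => H s * oddExp s) volume
  have h2 : ∫ s, H (-s) * oddExp (-s) = -∫ s, H s * oddExp s := by
    rw [← integral_neg]
    refine integral_congr_ae (ae_ne_zero.mono fun s hs => ?_)
    rcases lt_or_gt_of_ne hs with h | h
    · simp [hH, oddExp, h, h.le, not_lt.2 h.le, not_le.2 h]
    · simp [hH, oddExp, h, h.le, not_lt.2 h.le, not_le.2 h]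
  rw [h1] at h2
  exact self_eq_neg.1 h2

/-- The accelerant equation with `β = 0`, for `x ≥ 0`: the odd summand of `accelerantDual`
integrates to zero against the even `H`. -/
theorem integral_sub_mul_eq_of_nonneg {H : ℝ → ℂ} (hH : IsSmallKernel H) {x : ℝ} (hx : 0 ≤ x) :
    ∫ s in (0 : ℝ)..x, ((x - s : ℝ) : ℂ) * H s =
      (2 * Real.pi : ℂ)⁻¹ * ∫ ξ, ft H ξ * accelerantKernel x ξ := by
  rw [← integral_mul_accelerantDual hH.integrable hx]
  have h1 : Integrable fun s =>
      H s * (Ioc 0 x).indicator (fun s : ℝ => ((x - s : ℝ) : ℂ)) s := by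
    refine hH.integrable.mul_bdd (c := x) (integrable_indicator_sub x).1
      (Eventually.of_forall fun s => ?_)
    by_cases hs : s ∈ Ioc 0 x
    · rw [indicator_of_mem hs, Complex.norm_real, Real.norm_of_nonneg (by linarith [hs.2])]
      linarith [hs.1]
    · rw [indicator_of_notMem hs, norm_zero]
      exact hx
  have h2 : Integrable fun s => H s * ((x / 2 : ℂ) * oddExp s) := by
    refine hH.integrable.mul_bdd (c := x / 2) (integrable_oddExp.const_mul _).1
      (Eventually.of_forall fun s => ?_)
    have h3 : ‖oddExp s‖ ≤ 1 := by
      rcases le_or_gt s 0 with h | h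
      · simp [oddExp, h, not_lt.2 h, Complex.norm_exp]
      · simp [oddExp, h, not_le.2 h, Complex.norm_exp, h.le]
    have h4 : ‖(x / 2 : ℂ)‖ = x / 2 := by
      rw [show (x / 2 : ℂ) = ((x / 2 : ℝ) : ℂ) by push_cast; ring, Complex.norm_real,
        Real.norm_of_nonneg (by positivity)]
    rw [norm_mul, h4]
    exact mul_le_of_le_one_right (by positivity) h3
  simp only [accelerantDual, mul_sub]
  rw [integral_sub h1 h2]
  have h3 : ∫ s, H s * ((x / 2 : ℂ) * oddExp s) = 0 := by
    rw [← mul_zero (x / 2 : ℂ), ← integral_mul_oddExp_of_even hH.even, ← integral_const_mul]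
    congr 1
    ext s
    ring
  rw [h3, sub_zero, intervalIntegral.integral_of_le hx, ← integral_indicator measurableSet_Ioc]
  refine integral_congr_ae (Eventually.of_forall fun s => ?_)
  by_cases hs : s ∈ Ioc 0 x
  · simp only [indicator_of_mem hs, mul_comm]
  · simp only [indicator_of_notMem hs, mul_zero]

theorem accelerantKernel_neg (x ξ : ℝ) : accelerantKernel (-x) ξ = accelerantKernel x (-ξ) := by
  by_cases h : ξ = 0
  · simp [accelerantKernel, h]
  · simp [accelerantKernel, h]

/-- The accelerant equation with `β = 0`; for `x < 0` it is reduced to `-x` by the symmetry of `H`. -/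
theorem integrable_and_integral_sub_mul_eq {H : ℝ → ℂ} (hH : IsSmallKernel H) (x : ℝ) :
    Integrable (accelerantKernel x) ∧ ∫ s in (0 : ℝ)..x, ((x - s : ℝ) : ℂ) * H s =
      (2 * Real.pi : ℂ)⁻¹ * ∫ ξ, ft H ξ * accelerantKernel x ξ := by
  rcases le_total 0 x with hx | hx
  · exact ⟨integrable_accelerantKernel hx, integral_sub_mul_eq_of_nonneg hH hx⟩
  obtain ⟨y, rfl⟩ : ∃ y, x = -y := ⟨-x, by ring⟩
  have hy : 0 ≤ y := by linarith
  have hK : accelerantKernel (-y) = fun ξ => accelerantKernel y (-ξ) :=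
    funext fun ξ => accelerantKernel_neg y ξ
  refine ⟨hK ▸ (integrable_accelerantKernel hy).comp_neg, ?_⟩
  have h1 : ∫ ξ, ft H ξ * accelerantKernel (-y) ξ = ∫ ξ, ft H ξ * accelerantKernel y ξ := by
    rw [← integral_neg_eq_self (fun ξ => ft H ξ * accelerantKernel y ξ)]
    simp only [hK, ft_neg_of_even hH.even]
  rw [h1, ← integral_sub_mul_eq_of_nonneg hH hy]
  have h2 := intervalIntegral.integral_comp_neg (a := 0) (b := y)
    (fun s : ℝ => ((-y - s : ℝ) : ℂ) * H s)
  rw [neg_zero] at h2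
  rw [intervalIntegral.integral_symm, ← h2, ← intervalIntegral.integral_neg]
  congr 1
  ext s
  rw [hH.even]
  push_cast
  ring

theorem spectralMeasure_le {w : ℝ → ℝ} {C : ℝ} (hw : ∀ ξ, w ξ ≤ C) :
    spectralMeasure w ≤ ENNReal.ofReal (C / (2 * Real.pi)) • volume := by
  rw [spectralMeasure, ← withDensity_const]
  exact withDensity_mono (Eventually.of_forall fun ξ =>
    ENNReal.ofReal_le_ofReal (div_le_div_of_nonneg_right (hw ξ) (by positivity)))

theorem IsSmallKernel.isAccelerant {H : ℝ → ℂ} (hH : IsSmallKernel H) {w : ℝ → ℝ}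
    (hwm : Measurable w) (hw0 : ∀ ξ, 0 ≤ w ξ) (hw : ∀ ξ, (w ξ : ℂ) = 1 + ft H ξ) :
    IsAccelerant (spectralMeasure w) H where
  poisson_finite := by
    have hw2 : ∀ ξ, w ξ ≤ 2 := fun ξ => by
      have h1 : ‖(w ξ : ℂ)‖ ≤ 1 + ‖ft H ξ‖ := by
        rw [hw]
        exact (norm_add_le _ _).trans (by rw [norm_one])
      rw [Complex.norm_real, Real.norm_of_nonneg (hw0 ξ)] at h1
      linarith [norm_ft_le H ξ, hH.norm_lt]
    exact (integrable_inv_one_add_sq.smul_measure ENNReal.ofReal_ne_top).mono_measure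
      (spectralMeasure_le hw2)
  hermitian x := by rw [hH.even, hH.real]
  locL2 R := hH.memLp_two.restrict _
  eqn := by
    refine ⟨0, fun x => ?_⟩
    obtain ⟨hK, heq⟩ := integrable_and_integral_sub_mul_eq hH x
    rw [heq]
    have h1 : ∫ ξ, accelerantKernel x ξ ∂(spectralMeasure w) =
        (2 * Real.pi : ℂ)⁻¹ * ∫ ξ, (accelerantKernel x ξ + ft H ξ * accelerantKernel x ξ) := by
      rw [spectralMeasure, integral_withDensity_eq_integral_toReal_smul (by fun_prop)
        (Eventually.of_forall fun _ => ENNReal.ofReal_lt_top), ← integral_const_mul]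
      refine integral_congr_ae (Eventually.of_forall fun ξ => ?_)
      simp only
      rw [ENNReal.toReal_ofReal (div_nonneg (hw0 ξ) (by positivity)), Complex.real_smul]
      push_cast
      rw [hw]
      ring
    have h2 : Integrable fun ξ => ft H ξ * accelerantKernel x ξ :=
      hK.bdd_mul (c := ∫ s, ‖H s‖) (continuous_ft hH.integrable).aestronglyMeasurable
        (Eventually.of_forall fun ξ => norm_ft_le H ξ)
    rw [h1, integral_add hK h2]
    push_cast
    ring

/-- The functions `x ↦ ∫_0^x (x - s) D(s) ds` determine `D`: if one of them is linear, then
`∫_0^x D` is constant, by Lebesgue's differentiation theorem and continuity. -/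
theorem ae_eq_zero_of_integral_sub_mul_eq {D : ℝ → ℂ} (hD : LocallyIntegrable D) {c : ℂ}
    (h : ∀ x : ℝ, ∫ s in (0 : ℝ)..x, ((x - s : ℝ) : ℂ) * D s = c * x) : D =ᵐ[volume] 0 := by
  have hsD : LocallyIntegrable fun s : ℝ => (s : ℂ) * D s := by
    have := hD.smul_continuous (g := fun s : ℝ => (s : ℂ)) (by fun_prop)
    simpa [mul_comm] using this
  have hint : ∀ {f : ℝ → ℂ}, LocallyIntegrable f → ∀ a b : ℝ, IntervalIntegrable f volume a b :=
    fun hf a b => intervalIntegrable_iff.mpr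
      ((hf.integrableOn_isCompact isCompact_uIcc).mono_set uIoc_subset_uIcc)
  have hsplit : ∀ x : ℝ, (x : ℂ) * (∫ s in (0 : ℝ)..x, D s) - ∫ s in (0 : ℝ)..x, (s : ℂ) * D s =
      c * x := fun x => by
    rw [← h x, ← intervalIntegral.integral_const_mul,
      ← intervalIntegral.integral_sub ((hint hD 0 x).const_mul _) (hint hsD 0 x)]
    congr 1
    ext s
    push_cast
    ring
  have hcont : Continuous fun x : ℝ => ∫ s in (0 : ℝ)..x, D s :=
    intervalIntegral.continuous_primitive (hint hD) 0
  have hae : (fun x : ℝ => ∫ s in (0 : ℝ)..x, D s) =ᵐ[volume] fun _ => c := by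
    filter_upwards [LocallyIntegrable.ae_hasDerivAt_integral hD,
      LocallyIntegrable.ae_hasDerivAt_integral hsD] with x h1 h2
    have h3 := ((hasDerivAt_id x).ofReal_comp.mul (h1 0)).sub (h2 0)
    have h4 : HasDerivAt (fun x : ℝ => c * (x : ℂ)) (c * 1) x :=
      (hasDerivAt_id x).ofReal_comp.const_mul c
    have h5 := h3.unique (h4.congr_of_eventuallyEq (Eventually.of_forall fun y => hsplit y))
    simp only [id_eq, Complex.ofReal_one] at h5
    linear_combination h5
  have heq := (hcont.ae_eq_iff_eq volume continuous_const).1 hae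
  have hc : c = 0 := by
    have := congrFun heq 0
    simpa using this.symm
  filter_upwards [LocallyIntegrable.ae_hasDerivAt_integral hD] with x hx
  have h1 := hx 0
  rw [heq] at h1
  exact h1.unique (hasDerivAt_const x c)

theorem IsAccelerant.locallyIntegrable {σ : Measure ℝ} {H : ℝ → ℂ} (hH : IsAccelerant σ H) :
    LocallyIntegrable H := by
  rw [locallyIntegrable_iff]
  intro K hK
  obtain ⟨R, hR⟩ := hK.isBounded.subset_closedBall 0
  rw [Real.closedBall_eq_Icc, zero_sub, zero_add] at hR
  exact IntegrableOn.mono_set ((hH.locL2 R).integrable (by norm_num)) hR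

/-- The unknown constants `β` of two accelerants only contribute a linear function of `x`. -/
theorem IsAccelerant.ae_eq {σ : Measure ℝ} {H H' : ℝ → ℂ} (hH : IsAccelerant σ H)
    (hH' : IsAccelerant σ H') : H =ᵐ[volume] H' := by
  obtain ⟨β, hβ⟩ := hH.eqn
  obtain ⟨β', hβ'⟩ := hH'.eqn
  have hl := hH.locallyIntegrable
  have hl' := hH'.locallyIntegrable
  have hint : ∀ {f : ℝ → ℂ}, LocallyIntegrable f → ∀ x : ℝ,
      IntervalIntegrable (fun s : ℝ => ((x - s : ℝ) : ℂ) * f s) volume 0 x := fun hf x =>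
    IntervalIntegrable.continuousOn_mul (intervalIntegrable_iff.mpr
      ((hf.integrableOn_isCompact isCompact_uIcc).mono_set uIoc_subset_uIcc))
      (Continuous.continuousOn (by fun_prop))
  have h := ae_eq_zero_of_integral_sub_mul_eq (hl.sub hl') (c := Complex.I * (β - β'))
    fun x => by
      simp only [Pi.sub_apply, mul_sub]
      rw [intervalIntegral.integral_sub (hint hl x) (hint hl' x), hβ, hβ']
      ring
  filter_upwards [h] with x hx
  simpa [sub_eq_zero] using hx

/-! ### The Krein system of a small accelerant -/

theorem norm_exp_I_mul (ξ r : ℝ) : ‖Complex.exp (Complex.I * ξ * r)‖ = 1 := by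
  simpa using norm_exp_neg_I_mul (-ξ) r

theorem IsKreinSolution.exists_truncated {H : ℝ → ℂ} {σ : Measure ℝ} (hHσ : IsAccelerant σ H)
    {P : ℝ≥0 → ℝ → ℂ} (hP : IsKreinSolution σ P) (r : ℝ≥0) :
    ∃ A : ℝ → ℂ, Integrable A ∧
      A =ᵐ[volume] (Icc 0 (r : ℝ)).indicator (fun s => H s - conv H A s) ∧
      ∀ ξ : ℝ, P r ξ = Complex.exp (Complex.I * ξ * (r : ℝ)) -
        Complex.exp (Complex.I * ξ * (r : ℝ)) * ft A ξ := by
  obtain ⟨H', hH'σ, -, Γ, hΓ, hPΓ⟩ := hP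
  obtain ⟨A, hA, hAeq, hft⟩ :=
    exists_truncated_of_isResolventKernel (hH'σ.ae_eq hHσ) r.2 (hΓ r)
  refine ⟨A, hA, hAeq, fun ξ => ?_⟩
  rw [hPΓ]
  exact congrArg _ (hft ξ)

theorem IsSmallKernel.existsUnique_isKreinSolution {H : ℝ → ℂ} (hH : IsSmallKernel H)
    {σ : Measure ℝ} (hHσ : IsAccelerant σ H) : ∃! P : ℝ≥0 → ℝ → ℂ, IsKreinSolution σ P := by
  choose Γ hΓ using fun r : ℝ≥0 => hH.exists_isResolventKernel r.2
  -- Every solution is `e^{iξr} (1 - Â(ξ))` with a solution `A` of the truncated equation, and `Â` is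
  -- determined by the equation.
  refine ⟨_, ⟨H, hHσ, fun r hr => hH.isPositive hr, Γ, hΓ, fun r ξ => rfl⟩, ?_⟩
  intro P hP
  have hQ : IsKreinSolution σ _ :=
    ⟨H, hHσ, fun r hr => hH.isPositive hr, Γ, hΓ, fun r ξ => rfl⟩
  ext r ξ
  obtain ⟨A, hA, hAeq, hPA⟩ := hP.exists_truncated hHσ r
  obtain ⟨B, hB, hBeq, hQB⟩ := hQ.exists_truncated hHσ r
  rw [hPA, hQB, hH.ft_eq_of_truncated measurableSet_Icc hA hB hAeq hBeq]

/-- `|w - 1| ≤ 4 |a|` when `w |1 - a|² = 1` and `1 ≤ w ≤ 2`. -/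
theorem abs_sub_one_le {w : ℝ} {a : ℂ} (h1 : 1 ≤ w) (h2 : w ≤ 2)
    (h : (w : ℂ) * (1 - a) * conj (1 - a) = 1) : |w - 1| ≤ 4 * ‖a‖ := by
  have h3 : w * ‖1 - a‖ ^ 2 = 1 := by
    rw [mul_assoc, Complex.mul_conj, Complex.normSq_eq_norm_sq] at h
    exact_mod_cast h
  have h4 : ‖1 - a‖ ≤ 1 := by
    by_contra! h4
    nlinarith
  have h5 : 1 - ‖a‖ ≤ ‖1 - a‖ := by
    have := norm_sub_norm_le (1 : ℂ) a
    rwa [norm_one] at this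
  rw [abs_of_nonneg (by linarith)]
  have h6 : w - 1 = w * ((1 - ‖1 - a‖) * (1 + ‖1 - a‖)) := by linear_combination h3
  rw [h6]
  have h7 : (1 - ‖1 - a‖) * (1 + ‖1 - a‖) ≤ ‖a‖ * 2 :=
    mul_le_mul (by linarith) (by linarith) (by positivity) (norm_nonneg _)
  nlinarith [norm_nonneg a]

/-- A bound for `P(r, ·) - e^{i r ·}` in `L^p_w` that is uniform in `r` passes, by Fatou's lemma, to
the limit `Â` of `1 - e^{-iξr} P(r, ξ)`, and `w - 1 = O(Â)` by the spectral factorization. -/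
theorem IsSmallKernel.iSup_eLpNorm_eq_top {H : ℝ → ℂ} (hH : IsSmallKernel H) {w : ℝ → ℝ}
    (hwm : Measurable w) (hw1 : ∀ ξ, 1 ≤ w ξ) (hw : ∀ ξ, (w ξ : ℂ) = 1 + ft H ξ)
    {P : ℝ≥0 → ℝ → ℂ} (hP : IsKreinSolution (spectralMeasure w) P) {p : ℝ≥0∞}
    (hwp : ¬ MemLp (fun ξ => w ξ - 1) p volume) :
    ⨆ r : ℝ≥0, eLpNorm (fun ξ : ℝ => P r ξ - Complex.exp (Complex.I * ξ * (r : ℝ))) p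
      (weightMeasure w) = ∞ := by
  by_contra hne
  have hHσ := hH.isAccelerant hwm (fun ξ => zero_le_one.trans (hw1 ξ)) hw
  obtain ⟨A, hA, hAeq⟩ := exists_eq_indicator_sub_conv hH.integrable hH.norm_lt hH.integrable
    (measurableSet_Ici (a := (0 : ℝ)))
  choose B hB hBeq hPB using fun n : ℕ => hP.exists_truncated hHσ n
  have hnorm : ∀ n : ℕ, eLpNorm (ft (B n)) p (weightMeasure w) ≤
      ⨆ r : ℝ≥0, eLpNorm (fun ξ : ℝ => P r ξ - Complex.exp (Complex.I * ξ * (r : ℝ))) p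
        (weightMeasure w) := fun n => by
    refine le_trans (le_of_eq (eLpNorm_congr_norm_ae (Eventually.of_forall fun ξ => ?_)))
      (le_iSup (fun r : ℝ≥0 => eLpNorm (fun ξ : ℝ => P r ξ -
        Complex.exp (Complex.I * ξ * (r : ℝ))) p (weightMeasure w)) (n : ℝ≥0))
    rw [hPB, sub_sub_cancel_left, norm_neg, norm_mul, norm_exp_I_mul, one_mul]
  have hlim := Lp.eLpNorm_lim_le_liminf_eLpNorm (p := p) (μ := weightMeasure w)
    (fun n => (continuous_ft (hB n)).aestronglyMeasurable) (ft A)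
    (Eventually.of_forall fun ξ => hH.tendsto_ft hA (Eventually.of_forall fun s => by
      conv_lhs => rw [hAeq]) hB (fun n => by simpa using hBeq n) ξ)
  have hfin : eLpNorm (ft A) p (weightMeasure w) < ∞ := by
    refine (hlim.trans ?_).trans_lt (lt_top_iff_ne_top.2 hne)
    exact (liminf_le_liminf (Eventually.of_forall hnorm)).trans (by simp)
  have hvol : volume ≤ weightMeasure w := by
    rw [weightMeasure]
    conv_lhs => rw [← withDensity_one (μ := (volume : Measure ℝ))]
    exact withDensity_mono (Eventually.of_forall fun ξ => by simpa using hw1 ξ)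
  refine hwp ⟨(hwm.sub_const 1).aestronglyMeasurable, ?_⟩
  have hle : eLpNorm (fun ξ => w ξ - 1) p volume ≤ ENNReal.ofReal 4 * eLpNorm (ft A) p volume := by
    refine eLpNorm_le_mul_eLpNorm_of_ae_le_mul (Eventually.of_forall fun ξ => ?_) p
    have hle2 : w ξ ≤ 2 := by
      have h1 : ‖(w ξ : ℂ)‖ ≤ 1 + ‖ft H ξ‖ := by
        rw [hw]
        exact (norm_add_le _ _).trans (by rw [norm_one])
      rw [Complex.norm_real] at h1
      linarith [norm_ft_le H ξ, hH.norm_lt, le_abs_self (w ξ), Real.norm_eq_abs (w ξ)]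
    refine abs_sub_one_le (hw1 ξ) hle2 ?_
    rw [hw]
    exact one_add_ft_mul_normSq hH.integrable (fun x => by rw [hH.even, hH.real]) hA hAeq ξ
  exact hle.trans_lt (ENNReal.mul_lt_top ENNReal.ofReal_lt_top
    ((eLpNorm_mono_measure _ hvol).trans_lt hfin))

theorem apCharacteristic_two_le {w : ℝ → ℝ} {C : ℝ} (hw1 : ∀ x, 1 ≤ w x) (hwC : ∀ x, w x ≤ C) :
    apCharacteristic 2 w ≤ ENNReal.ofReal C := by
  refine iSup_le fun a => iSup_le fun b => iSup_le fun hab => ?_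
  have hab' : ENNReal.ofReal (b - a) ≠ 0 := by simpa using hab
  have h1 : (∫⁻ x in Ioo a b, ENNReal.ofReal (w x)) / ENNReal.ofReal (b - a) ≤
      ENNReal.ofReal C := by
    rw [ENNReal.div_le_iff hab' ENNReal.ofReal_ne_top, ← Real.volume_Ioo, ← setLIntegral_const]
    exact lintegral_mono fun x => ENNReal.ofReal_le_ofReal (hwC x)
  have h2 : (∫⁻ x in Ioo a b, ENNReal.ofReal (w x) ^ (1 / (1 - 2) : ℝ)) /
      ENNReal.ofReal (b - a) ≤ 1 := by
    rw [ENNReal.div_le_iff hab' ENNReal.ofReal_ne_top, ← Real.volume_Ioo, ← setLIntegral_const]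
    refine lintegral_mono fun x => ?_
    rw [show (1 / (1 - 2) : ℝ) = -1 by norm_num, ENNReal.rpow_neg_one, ENNReal.inv_le_one]
    simpa using hw1 x
  rw [show (2 - 1 : ℝ) = 1 by norm_num, ENNReal.rpow_one]
  simpa using mul_le_mul' h1 h2

/-! ### A lacunary sum of Gaussians -/

theorem eLpNorm_le_tsum {f : ℕ → ℝ → ℝ} {F : ℝ → ℝ} {p : ℝ≥0∞} (hp : 1 ≤ p)
    (hf : ∀ n, AEStronglyMeasurable (f n) volume) (h : ∀ᵐ x, HasSum (fun n => f n x) (F x)) :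
    eLpNorm F p volume ≤ ∑' n, eLpNorm (f n) p volume := by
  have hmeas : ∀ n, AEStronglyMeasurable (∑ i ∈ Finset.range n, f i) volume := fun n =>
    Finset.aestronglyMeasurable_sum _ fun i _ => hf i
  refine (Lp.eLpNorm_lim_le_liminf_eLpNorm hmeas F (h.mono fun x hx => ?_)).trans ?_
  · simpa using hx.tendsto_sum_nat
  · refine (liminf_le_liminf (v := fun _ => ∑' n, eLpNorm (f n) p volume)
      (Eventually.of_forall fun n => ?_)).trans (by simp)
    exact (eLpNorm_sum_le (fun i _ => hf i) hp).trans (ENNReal.sum_le_tsum _)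

theorem aestronglyMeasurable_of_hasSum {f : ℕ → ℝ → ℝ} {F : ℝ → ℝ}
    (hf : ∀ n, AEStronglyMeasurable (f n) volume) (h : ∀ᵐ x, HasSum (fun n => f n x) (F x)) :
    AEStronglyMeasurable F volume :=
  aestronglyMeasurable_of_tendsto_ae atTop
    (fun n => Finset.aestronglyMeasurable_sum (Finset.range n) fun i _ => hf i)
    (h.mono fun x hx => by simpa using hx.tendsto_sum_nat)

theorem eLpNorm_const_mul_gaussian {b p c : ℝ} (hb : 0 < b) (hp : 0 < p) (hc : 0 ≤ c) :
    eLpNorm (fun x : ℝ => c * Real.exp (-b * x ^ 2)) (ENNReal.ofReal p) volume =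
      ENNReal.ofReal (c * √(Real.pi / (p * b)) ^ (1 / p)) := by
  have h1 : eLpNorm (fun x : ℝ => Real.exp (-b * x ^ 2)) (ENNReal.ofReal p) volume =
      ENNReal.ofReal (√(Real.pi / (p * b)) ^ (1 / p)) := by
    rw [eLpNorm_eq_lintegral_rpow_enorm_toReal (by simpa using hp) ENNReal.ofReal_ne_top,
      ENNReal.toReal_ofReal hp.le, ← ENNReal.ofReal_rpow_of_nonneg (by positivity) (by positivity),
      ← integral_gaussian, ofReal_integral_eq_lintegral_ofReal
        (integrable_exp_neg_mul_sq (by positivity))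
        (Eventually.of_forall fun x => (Real.exp_pos _).le)]
    congr 1
    refine lintegral_congr fun x => ?_
    rw [Real.enorm_of_nonneg (Real.exp_pos _).le,
      ENNReal.ofReal_rpow_of_nonneg (Real.exp_pos _).le hp.le, ← Real.exp_mul]
    congr 2
    ring
  have h2 := eLpNorm_const_smul c (fun x : ℝ => Real.exp (-b * x ^ 2)) (ENNReal.ofReal p) volume
  rw [h1, Real.enorm_of_nonneg hc, ← ENNReal.ofReal_mul hc] at h2
  exact h2

theorem ft_gaussian {a : ℝ} (ha : 0 < a) (c ξ : ℝ) :
    ft (fun s : ℝ => ((c * (a * Real.exp (-(Real.pi * a ^ 2) * s ^ 2)) : ℝ) : ℂ)) ξ =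
      ((c * Real.exp (-(1 / (4 * Real.pi * a ^ 2)) * ξ ^ 2) : ℝ) : ℂ) := by
  have hre : 0 < ((a : ℂ) ^ 2).re := by
    rw [← Complex.ofReal_pow, Complex.ofReal_re]
    positivity
  have h1 : ft (fun s : ℝ => ((c * (a * Real.exp (-(Real.pi * a ^ 2) * s ^ 2)) : ℝ) : ℂ)) ξ =
      (c * a : ℂ) * ft (fun s : ℝ => Complex.exp (-Real.pi * (a : ℂ) ^ 2 * s ^ 2)) ξ := by
    simp only [ft]
    rw [← integral_const_mul]
    congr 1
    ext s
    push_cast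
    ring_nf
  have hcpow : ((a : ℂ) ^ 2) ^ (1 / 2 : ℂ) = a := by
    rw [one_div]
    exact Complex.sq_cpow_two_inv (by simpa using ha)
  have ha' : (a : ℂ) ≠ 0 := by exact_mod_cast ha.ne'
  have hpi : (Real.pi : ℂ) ≠ 0 := by exact_mod_cast Real.pi_ne_zero
  rw [h1, ft_eq_fourier, fourier_gaussian_pi hre]
  simp only [hcpow]
  push_cast
  have h2 : -(Real.pi : ℂ) / (a : ℂ) ^ 2 * ((ξ : ℂ) / (2 * Real.pi)) ^ 2 =
      -(1 / (4 * Real.pi * (a : ℂ) ^ 2)) * (ξ : ℂ) ^ 2 := by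
    field_simp
    ring
  rw [h2]
  field_simp

theorem summable_one_div_succ_sq : Summable fun n : ℕ => 1 / ((n : ℝ) + 1) ^ 2 := by
  have h := (summable_nat_add_iff 1).2 (Real.summable_one_div_nat_pow.2 one_lt_two)
  simpa using h

/-- For every `1 < q ≤ 2` and `0 < ε < 1` there is a small kernel `H` with `0 ≤ Ĥ ≤ ε` and
`Ĥ ∈ L^q`, which belongs to no `L^p` with `p < q`. It is `H = ∑ βₙ 2ⁿ e^{-π 4ⁿ s²}`, with
`βₙ = κ 2^{-n/q} / (n+1)²`: the transform of the `n`-th term is of size `βₙ` on an interval of length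
`2ⁿ`, so its `L^q` norm is `O((n+1)⁻²)`, while the `L^p` norm grows exponentially for `p < q`. -/
theorem exists_isSmallKernel {q : ℝ} (hq : 1 < q) (hq2 : q ≤ 2) {ε : ℝ} (hε : 0 < ε)
    (hε1 : ε < 1) :
    ∃ (H : ℝ → ℂ) (u : ℝ → ℝ), IsSmallKernel H ∧ (∀ ξ, (u ξ : ℂ) = ft H ξ) ∧ Continuous u ∧
      (∀ ξ, 0 ≤ u ξ) ∧ (∀ ξ, u ξ ≤ ε) ∧ MemLp u (ENNReal.ofReal q) volume ∧
      ∀ p : ℝ, 0 < p → p < q → ¬ MemLp u (ENNReal.ofReal p) volume := by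
  have hq0 : 0 < q := by linarith
  set Z : ℝ := ∑' n : ℕ, 1 / ((n : ℝ) + 1) ^ 2 with hZ
  have hZpos : 0 < Z := summable_one_div_succ_sq.tsum_pos (fun n => by positivity) 0 (by norm_num)
  set κ : ℝ := ε / Z with hκ
  have hκpos : 0 < κ := by positivity
  set ρ : ℝ := (2 : ℝ) ^ (-(1 / q)) with hρ
  have hρpos : 0 < ρ := by positivity
  have hρ1 : ρ ≤ 1 := Real.rpow_le_one_of_one_le_of_nonpos one_le_two (by
    rw [neg_nonpos]; positivity)
  set β : ℕ → ℝ := fun n => κ * ρ ^ n * (1 / ((n : ℝ) + 1) ^ 2) with hβ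
  have hβpos : ∀ n, 0 < β n := fun n => by positivity
  have hβle : ∀ n, β n ≤ κ * (1 / ((n : ℝ) + 1) ^ 2) := fun n => by
    have : κ * ρ ^ n ≤ κ := mul_le_of_le_one_right hκpos.le (pow_le_one₀ hρpos.le hρ1)
    exact mul_le_mul_of_nonneg_right this (by positivity)
  have hκsum : Summable fun n : ℕ => κ * (1 / ((n : ℝ) + 1) ^ 2) :=
    summable_one_div_succ_sq.mul_left κ
  have hβsum : Summable β := hκsum.of_nonneg_of_le (fun n => (hβpos n).le) hβle
  have hβtot : ∑' n, β n ≤ ε := by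
    refine (hβsum.tsum_le_tsum hβle hκsum).trans (le_of_eq ?_)
    rw [tsum_mul_left, ← hZ, hκ, div_mul_cancel₀ _ hZpos.ne']
  -- `ρⁿ` cancels the growth `2^{n/q}` of the norms in `L^q`, and a fortiori `2^{n/2}` in `L²`.
  have hρq : ∀ n : ℕ, ρ ^ n * ((2 : ℝ) ^ n) ^ (1 / q) = 1 := fun n => by
    rw [hρ, ← Real.rpow_natCast, ← Real.rpow_natCast, ← Real.rpow_mul (by norm_num),
      ← Real.rpow_mul (by norm_num), ← Real.rpow_add (by norm_num)]
    ring_nf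
    exact Real.rpow_zero 2
  have hone : ∀ n : ℕ, (1 : ℝ) ≤ 2 ^ n := fun n => one_le_pow₀ one_le_two
  have hρ2 : ∀ n : ℕ, ρ ^ n * ((2 : ℝ) ^ n) ^ (1 / 2 : ℝ) ≤ 1 := fun n => by
    refine le_trans (mul_le_mul_of_nonneg_left
      (Real.rpow_le_rpow_of_exponent_le (hone n) ?_) (by positivity)) (hρq n).le
    exact one_div_le_one_div_of_le hq0 hq2
  set g : ℕ → ℝ → ℝ := fun n s =>
    β n * ((2 : ℝ) ^ n * Real.exp (-(Real.pi * ((2 : ℝ) ^ n) ^ 2) * s ^ 2)) with hg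
  set e : ℕ → ℝ → ℝ := fun n ξ =>
    β n * Real.exp (-(1 / (4 * Real.pi * ((2 : ℝ) ^ n) ^ 2)) * ξ ^ 2) with he
  have hg0 : ∀ n s, 0 ≤ g n s := fun n s => by have := hβpos n; positivity
  have he0 : ∀ n ξ, 0 ≤ e n ξ := fun n s => by have := hβpos n; positivity
  have hele : ∀ n ξ, e n ξ ≤ β n := fun n ξ => by
    refine mul_le_of_le_one_right (hβpos n).le (Real.exp_le_one_iff.2 ?_)
    rw [neg_mul, neg_nonpos]
    positivity
  have hesum : ∀ ξ, Summable fun n => e n ξ := fun ξ =>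
    hβsum.of_nonneg_of_le (fun n => he0 n ξ) fun n => hele n ξ
  have hgm : ∀ n, AEStronglyMeasurable (g n) volume := fun n =>
    (show Continuous (g n) by fun_prop).aestronglyMeasurable
  have hec : ∀ n, Continuous (e n) := fun n => by fun_prop
  have hgsum : ∀ s, s ≠ 0 → Summable fun n => g n s := fun s hs => by
    refine (hβsum.mul_right (1 / (Real.pi * s ^ 2))).of_nonneg_of_le (fun n => hg0 n s)
      fun n => mul_le_mul_of_nonneg_left ?_ (hβpos n).le
    have hy : 0 < Real.pi * ((2 : ℝ) ^ n) ^ 2 * s ^ 2 := by positivity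
    have h1 : Real.exp (-(Real.pi * ((2 : ℝ) ^ n) ^ 2) * s ^ 2) ≤
        1 / (Real.pi * ((2 : ℝ) ^ n) ^ 2 * s ^ 2) := by
      rw [neg_mul, Real.exp_neg, ← one_div]
      refine one_div_le_one_div_of_le hy ?_
      have := Real.add_one_le_exp (Real.pi * ((2 : ℝ) ^ n) ^ 2 * s ^ 2)
      linarith
    refine (mul_le_mul_of_nonneg_left h1 (by positivity)).trans ?_
    rw [mul_one_div, div_le_div_iff₀ hy (by positivity)]
    have h2 : (2 : ℝ) ^ n ≤ ((2 : ℝ) ^ n) ^ 2 := by nlinarith [hone n]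
    have h3 : 0 < Real.pi * s ^ 2 := by positivity
    nlinarith
  set h : ℝ → ℝ := fun s => ∑' n, g n s with hh
  set u : ℝ → ℝ := fun ξ => ∑' n, e n ξ with hu
  have hhas : ∀ᵐ s : ℝ, HasSum (fun n => g n s) (h s) :=
    ae_ne_zero.mono fun s hs => (hgsum s hs).hasSum
  have huhas : ∀ ξ : ℝ, HasSum (fun n => e n ξ) (u ξ) := fun ξ => (hesum ξ).hasSum
  have hhm : AEStronglyMeasurable h volume := aestronglyMeasurable_of_hasSum hgm hhas
  have hgnorm : ∀ (p : ℝ), 0 < p → ∀ n, eLpNorm (g n) (ENNReal.ofReal p) volume =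
      ENNReal.ofReal (β n * 2 ^ n *
        √(Real.pi / (p * (Real.pi * ((2 : ℝ) ^ n) ^ 2))) ^ (1 / p)) := fun p hp n => by
    rw [← eLpNorm_const_mul_gaussian (by positivity) hp
      (mul_nonneg (hβpos n).le (by positivity))]
    congr 1
    ext s
    simp only [hg]
    ring
  have hg1 : ∀ n, eLpNorm (g n) 1 volume = ENNReal.ofReal (β n) := fun n => by
    have h1 := hgnorm 1 one_pos n
    have h2 : Real.pi / (1 * (Real.pi * ((2 : ℝ) ^ n) ^ 2)) = (1 / 2 ^ n) ^ 2 := by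
      field_simp
    rw [ENNReal.ofReal_one, h2, Real.sqrt_sq (by positivity), div_one, Real.rpow_one,
      mul_assoc, mul_one_div_cancel (by positivity), mul_one] at h1
    exact h1
  have hg2 : ∀ n, eLpNorm (g n) 2 volume ≤ ENNReal.ofReal (κ * (1 / ((n : ℝ) + 1) ^ 2)) :=
      fun n => by
    have h1 := hgnorm 2 two_pos n
    rw [ENNReal.ofReal_ofNat] at h1
    rw [h1]
    refine ENNReal.ofReal_le_ofReal ?_
    have h2 : √(Real.pi / (2 * (Real.pi * ((2 : ℝ) ^ n) ^ 2))) ≤ 1 / 2 ^ n := by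
      refine Real.sqrt_le_iff.2 ⟨by positivity, ?_⟩
      rw [div_pow, one_pow, div_le_div_iff₀ (by positivity) (by positivity)]
      nlinarith [show 0 < Real.pi * ((2 : ℝ) ^ n) ^ 2 by positivity]
    have h3 : √(Real.pi / (2 * (Real.pi * ((2 : ℝ) ^ n) ^ 2))) ^ (1 / 2 : ℝ) ≤
        (1 / 2 ^ n) ^ (1 / 2 : ℝ) := Real.rpow_le_rpow (Real.sqrt_nonneg _) h2 (by norm_num)
    have h4 : (2 : ℝ) ^ n * (1 / 2 ^ n) ^ (1 / 2 : ℝ) = ((2 : ℝ) ^ n) ^ (1 / 2 : ℝ) := by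
      rw [Real.div_rpow zero_le_one (by positivity), Real.one_rpow, ← Real.sqrt_eq_rpow]
      rw [mul_one_div, Real.div_sqrt]
    calc β n * 2 ^ n * √(Real.pi / (2 * (Real.pi * ((2 : ℝ) ^ n) ^ 2))) ^ (1 / 2 : ℝ)
        ≤ β n * 2 ^ n * (1 / 2 ^ n) ^ (1 / 2 : ℝ) :=
          mul_le_mul_of_nonneg_left h3 (mul_nonneg (hβpos n).le (by positivity))
      _ = κ * (1 / ((n : ℝ) + 1) ^ 2) * (ρ ^ n * ((2 : ℝ) ^ n) ^ (1 / 2 : ℝ)) := by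
          rw [mul_assoc, h4]
          simp only [hβ]
          ring
      _ ≤ κ * (1 / ((n : ℝ) + 1) ^ 2) := mul_le_of_le_one_right (by positivity) (hρ2 n)
  have hh1 : eLpNorm h 1 volume ≤ ENNReal.ofReal ε := by
    refine (eLpNorm_le_tsum le_rfl hgm hhas).trans ?_
    simp only [hg1]
    rw [← ENNReal.ofReal_tsum_of_nonneg (fun n => (hβpos n).le) hβsum]
    exact ENNReal.ofReal_le_ofReal hβtot
  have hh2 : eLpNorm h 2 volume < ∞ := by
    refine ((eLpNorm_le_tsum one_le_two hgm hhas).trans (ENNReal.tsum_le_tsum hg2)).trans_lt ?_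
    rw [← ENNReal.ofReal_tsum_of_nonneg (fun n => by positivity) hκsum]
    exact ENNReal.ofReal_lt_top
  have hgint : ∀ n, Integrable (g n) := fun n =>
    memLp_one_iff_integrable.1 ⟨hgm n, by rw [hg1]; exact ENNReal.ofReal_lt_top⟩
  have hgnormint : ∀ n, ∫ s, ‖g n s‖ = β n := fun n => by
    rw [integral_norm_eq_lintegral_enorm (hgm n), ← eLpNorm_one_eq_lintegral_enorm, hg1,
      ENNReal.toReal_ofReal (hβpos n).le]
  have hsmall : IsSmallKernel fun s => (h s : ℂ) :=
    { integrable := (memLp_one_iff_integrable.1 ⟨hhm, hh1.trans_lt ENNReal.ofReal_lt_top⟩).ofReal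
      memLp_two := MemLp.ofReal ⟨hhm, hh2⟩
      even := fun x => by simp only [hh, hg, neg_sq]
      real := fun x => Complex.conj_ofReal _
      norm_lt := by
        simp only [Complex.norm_real]
        rw [integral_norm_eq_lintegral_enorm hhm, ← eLpNorm_one_eq_lintegral_enorm]
        exact (ENNReal.toReal_le_of_le_ofReal hε.le hh1).trans_lt hε1 }
  have hft : ∀ ξ, (u ξ : ℂ) = ft (fun s => (h s : ℂ)) ξ := fun ξ => by
    have h1 := hasSum_integral_of_summable_integral_norm
      (F := fun (n : ℕ) (s : ℝ) => Complex.exp (-(Complex.I * ξ * s)) * (g n s : ℂ))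
      (μ := volume) (fun n => integrable_exp_mul (hgint n).ofReal ξ)
      (by simpa only [norm_mul, norm_exp_neg_I_mul, one_mul, Complex.norm_real, hgnormint]
        using hβsum)
    have h2 : ∫ s : ℝ, ∑' n : ℕ, Complex.exp (-(Complex.I * ξ * s)) * (g n s : ℂ) =
        ft (fun s => (h s : ℂ)) ξ := by
      rw [ft]
      congr 1
      ext s
      rw [tsum_mul_left, hh, Complex.ofReal_tsum]
    rw [h2] at h1
    have h3 : ∀ n, ∫ s : ℝ, Complex.exp (-(Complex.I * ξ * s)) * (g n s : ℂ) = (e n ξ : ℂ) :=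
      fun n => ft_gaussian (by positivity) (β n) ξ
    simp only [h3] at h1
    exact (Complex.hasSum_ofReal.2 (huhas ξ)).unique h1
  have huc : Continuous u := continuous_tsum hec hβsum fun n ξ => by
    rw [Real.norm_of_nonneg (he0 n ξ)]
    exact hele n ξ
  have hu0 : ∀ ξ, 0 ≤ u ξ := fun ξ => tsum_nonneg fun n => he0 n ξ
  refine ⟨fun s => (h s : ℂ), u, hsmall, hft, huc, hu0,
    fun ξ => ((hesum ξ).tsum_le_tsum (fun n => hele n ξ) hβsum).trans hβtot, ?_, ?_⟩
  · refine ⟨huc.aestronglyMeasurable, ?_⟩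
    set C : ℝ := √(4 * Real.pi ^ 2 / q) ^ (1 / q) with hC
    have henorm : ∀ n, eLpNorm (e n) (ENNReal.ofReal q) volume =
        ENNReal.ofReal (κ * (1 / ((n : ℝ) + 1) ^ 2) * C) := fun n => by
      rw [show e n = fun ξ : ℝ => β n *
        Real.exp (-(1 / (4 * Real.pi * ((2 : ℝ) ^ n) ^ 2)) * ξ ^ 2) from rfl,
        eLpNorm_const_mul_gaussian (by positivity) hq0 (hβpos n).le]
      congr 1
      have h1 : Real.pi / (q * (1 / (4 * Real.pi * ((2 : ℝ) ^ n) ^ 2))) =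
          4 * Real.pi ^ 2 / q * ((2 : ℝ) ^ n) ^ 2 := by
        field_simp
      rw [h1, Real.sqrt_mul (by positivity), Real.sqrt_sq (by positivity),
        Real.mul_rpow (by positivity) (by positivity), ← hC]
      calc β n * (C * ((2 : ℝ) ^ n) ^ (1 / q))
          = κ * (1 / ((n : ℝ) + 1) ^ 2) * C * (ρ ^ n * ((2 : ℝ) ^ n) ^ (1 / q)) := by
            simp only [hβ]
            ring
        _ = _ := by rw [hρq, mul_one]
    refine (eLpNorm_le_tsum (by simpa using hq.le) (fun n => (hec n).aestronglyMeasurable)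
      (Eventually.of_forall huhas)).trans_lt ?_
    simp only [henorm]
    rw [← ENNReal.ofReal_tsum_of_nonneg (fun n => by positivity) (hκsum.mul_right C)]
    exact ENNReal.ofReal_lt_top
  · intro p hp hpq hmem
    set θ : ℝ := ρ * (2 : ℝ) ^ (1 / p) with hθ
    have hθ1 : 1 < θ := by
      rw [hθ, hρ, ← Real.rpow_add two_pos]
      refine Real.one_lt_rpow one_lt_two ?_
      have := one_div_lt_one_div_of_lt hp hpq
      linarith
    -- On `[0, 2ⁿ]` the `n`-th term is at least `βₙ / 2`.
    have hlow : ∀ n : ℕ, β n / 2 * ((2 : ℝ) ^ n) ^ (1 / p) ≤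
        (eLpNorm u (ENNReal.ofReal p) volume).toReal := fun n => by
      have hle : eLpNorm ((Icc 0 ((2 : ℝ) ^ n)).indicator fun _ => β n / 2)
          (ENNReal.ofReal p) volume ≤ eLpNorm u (ENNReal.ofReal p) volume := by
        refine eLpNorm_mono fun ξ => ?_
        rw [Real.norm_of_nonneg (hu0 ξ)]
        by_cases hξ : ξ ∈ Icc 0 ((2 : ℝ) ^ n)
        · rw [indicator_of_mem hξ, Real.norm_of_nonneg (by have := hβpos n; positivity)]
          refine le_trans ?_ ((hesum ξ).le_tsum n fun m _ => he0 m ξ)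
          have h1 : 1 / (4 * Real.pi * ((2 : ℝ) ^ n) ^ 2) * ξ ^ 2 ≤ 1 / 2 := by
            rw [one_div_mul_eq_div, div_le_div_iff₀ (by positivity) (by positivity)]
            have h2 : ξ ^ 2 ≤ ((2 : ℝ) ^ n) ^ 2 := pow_le_pow_left₀ hξ.1 hξ.2 2
            nlinarith [Real.pi_gt_three, sq_nonneg ξ]
          have h3 : 1 / 2 ≤ Real.exp (-(1 / (4 * Real.pi * ((2 : ℝ) ^ n) ^ 2)) * ξ ^ 2) := by
            have := Real.add_one_le_exp (-(1 / (4 * Real.pi * ((2 : ℝ) ^ n) ^ 2)) * ξ ^ 2)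
            linarith
          simp only [he]
          rw [div_eq_mul_one_div]
          exact mul_le_mul_of_nonneg_left h3 (hβpos n).le
        · rw [indicator_of_notMem hξ, norm_zero]
          exact hu0 ξ
      rw [eLpNorm_indicator_const measurableSet_Icc (by simpa using hp) ENNReal.ofReal_ne_top,
        Real.volume_Icc, sub_zero, ENNReal.toReal_ofReal hp.le,
        Real.enorm_of_nonneg (by have := hβpos n; positivity),
        ENNReal.ofReal_rpow_of_nonneg (by positivity) (by positivity),
        ← ENNReal.ofReal_mul (by have := hβpos n; positivity)] at hle
      exact (ENNReal.ofReal_le_iff_le_toReal hmem.2.ne).1 hle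
    set M : ℝ := (eLpNorm u (ENNReal.ofReal p) volume).toReal with hM
    have hβθ : ∀ n : ℕ, β n / 2 * ((2 : ℝ) ^ n) ^ (1 / p) =
        κ / 2 * θ ^ n / ((n : ℝ) + 1) ^ 2 := fun n => by
      rw [hθ, mul_pow, ← Real.rpow_natCast ((2 : ℝ) ^ (1 / p)), ← Real.rpow_mul two_pos.le,
        ← Real.rpow_natCast 2 n, ← Real.rpow_mul two_pos.le, mul_comm (1 / p)]
      simp only [hβ]
      ring
    have hlim : Tendsto (fun n : ℕ => ((n + 1 : ℕ) : ℝ) ^ 2 / θ ^ (n + 1)) atTop (𝓝 0) :=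
      (tendsto_pow_const_div_const_pow_of_one_lt 2 hθ1).comp (tendsto_add_atTop_nat 1)
    have hbd : ∀ n : ℕ, κ / (2 * θ) ≤ M * (((n + 1 : ℕ) : ℝ) ^ 2 / θ ^ (n + 1)) := fun n => by
      have h1 := hlow n
      have hθ0 : 0 < θ := by linarith
      rw [hβθ, div_le_iff₀ (by positivity)] at h1
      push_cast
      rw [← mul_div_assoc, div_le_div_iff₀ (by positivity) (by positivity), pow_succ]
      nlinarith
    have h0 : κ / (2 * θ) ≤ 0 := by
      have := ge_of_tendsto' (hlim.const_mul M) hbd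
      rwa [mul_zero] at this
    have : 0 < κ / (2 * θ) := by positivity
    linarith

end Krein

theorem mainTheorem4 (p₂ : ℝ) (hp₂ : 1 < p₂) (hp₂' : p₂ ≤ 2) (δ : ℝ) (hδ : 0 < δ) :
    ∃ w : ℝ → ℝ, Measurable w ∧ (∀ x, 0 ≤ w x) ∧
      MemLp (fun x => w x - 1) (ENNReal.ofReal p₂) volume ∧
      Krein.apCharacteristic 2 w ≤ ENNReal.ofReal (1 + δ) ∧
      (∃! P : ℝ≥0 → ℝ → ℂ, Krein.IsKreinSolution (Krein.spectralMeasure w) P) ∧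
      ∀ P : ℝ≥0 → ℝ → ℂ, Krein.IsKreinSolution (Krein.spectralMeasure w) P →
        ∀ p : ℝ, 0 < p → p < p₂ →
          ⨆ r : ℝ≥0, eLpNorm (fun ξ : ℝ => P r ξ - Complex.exp (Complex.I * ξ * (r : ℝ)))
            (ENNReal.ofReal p) (Krein.weightMeasure w) = ∞ := by
  obtain ⟨H, u, hH, hu, huc, hu0, huε, huq, hup⟩ := Krein.exists_isSmallKernel hp₂ hp₂'
    (ε := min δ (1 / 2)) (by positivity) (by linarith [min_le_right δ (1 / 2)])
  have hwm : Measurable fun ξ => 1 + u ξ := (huc.const_add 1).measurable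
  have hw1 : ∀ ξ, 1 ≤ 1 + u ξ := fun ξ => by linarith [hu0 ξ]
  have hw : ∀ ξ, ((1 + u ξ : ℝ) : ℂ) = 1 + Krein.ft H ξ := fun ξ => by
    rw [Complex.ofReal_add, hu, Complex.ofReal_one]
  have hw0 : ∀ ξ, 0 ≤ 1 + u ξ := fun ξ => zero_le_one.trans (hw1 ξ)
  refine ⟨fun ξ => 1 + u ξ, hwm, hw0, by simpa only [add_sub_cancel_left] using huq,
    Krein.apCharacteristic_two_le hw1 fun ξ => by linarith [huε ξ, min_le_left δ (1 / 2)],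
    hH.existsUnique_isKreinSolution (hH.isAccelerant hwm hw0 hw), fun P hP p hp hpq => ?_⟩
  exact hH.iSup_eLpNorm_eq_top hwm hw1 hw hP
    (by simpa only [add_sub_cancel_left] using hup p hp hpq)
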